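/- Let $\mathbb D=\{z\in\mathbb C:|z|<1\}$. For $\gamma\in\mathbb R$ let $K_{(\gamma)}(z,w)=\sum_{n=0}^\infty (n+1)^{\gamma}(z\bar w)^n$, $z,w\in\mathbb D$, let $(\mathcal H,K_{(\gamma)})$ be the reproducing kernel Hilbert space of functions on $\mathbb D$ with kernel $K_{(\gamma)}$, and let $M_z$ be the operator $(M_zf)(z)=zf(z)$ on it. For $\theta\in\mathbb R$ and $a\in\mathbb D$ put $\varphi_{\theta,a}(z)=e^{i\theta}\frac{z-a}{1-\bar a z}$; these maps form the Möbius group. A bounded operator $T$ on a Hilbert space is called homogeneous (respectively weakly homogeneous) if its spectrum $\sigma(T)$ is contained in $\overline{\mathbb D}$ and, for every $\varphi=\varphi_{\theta,a}$, the operator $\varphi(T)$ defined by the holomorphic functional calculus is unitarily equivalent (respectively similar, by a bounded invertible operator) to $T$. A bounded operator $T$ on a Hilbert space $\mathcal H$ belongs to the Cowen–Douglas class $B_1(\mathbb D)$ if for every $w\in\mathbb D$ the space $\ker(T-w)$ is one-dimensional and the range of $T-w$ is closed, and the closed linear span of all $\ker(T-w)$, $w\in\mathbb D$, is $\mathcal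 H$. Then for every $\gamma\in\mathbb R$ the operator $M_z$ is bounded on $(\mathcal H,K_{(\gamma)})$, and its adjoint $M_z^*$ is a weakly homogeneous operator belonging to $B_1(\mathbb D)$. Moreover, $M_z^*$ is similar to a homogeneous operator if and only if $\gamma>-1$. In particular, $M_z^*$ on the Dirichlet space $(\mathcal H,K_{(-1)})$ is weakly homogeneous but is not similar to any homogeneous operator. -/

import Mathlib

open scoped ComplexConjugate ComplexOrder

noncomputable section

/-- The kernel `K_(γ)(z, w) = ∑ (n + 1) ^ γ (z w̄) ^ n` on the unit disc (a scalar `c` is regarded as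
the operator `c • id` on `ℂ`). -/
def powerKernel (γ : ℝ) : Matrix Complex.UnitDisc Complex.UnitDisc (ℂ →L[ℂ] ℂ) :=
  Matrix.of fun z w =>
    (∑' n : ℕ, ((((n : ℝ) + 1) ^ γ : ℝ) : ℂ) * ((z : ℂ) * conj (w : ℂ)) ^ n) •
      ContinuousLinearMap.id ℂ ℂ

/-- The series defining the kernel converges. -/
theorem powerKernel_summable (γ : ℝ) (z w : Complex.UnitDisc) :
    Summable fun n : ℕ => ((((n : ℝ) + 1) ^ γ : ℝ) : ℂ) * ((z : ℂ) * conj (w : ℂ)) ^ n := by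
  have hr : ‖(z : ℂ) * conj (w : ℂ)‖ < 1 := by
    rw [norm_mul, RCLike.norm_conj]
    have hz := z.norm_lt_one
    have hw := w.norm_lt_one
    nlinarith [norm_nonneg (z : ℂ), norm_nonneg (w : ℂ)]
  obtain ⟨k, hk⟩ := exists_nat_ge γ
  have h1 : Summable fun n : ℕ => ‖((n : ℂ) + 1) ^ k * ((z : ℂ) * conj (w : ℂ)) ^ n‖ := by
    have : ∀ n : ℕ, ((n : ℂ) + 1) ^ k * ((z : ℂ) * conj (w : ℂ)) ^ n
        = ∑ i ∈ Finset.range (k + 1),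
          (k.choose i : ℂ) * ((n : ℂ) ^ i * ((z : ℂ) * conj (w : ℂ)) ^ n) := by
      intro n
      rw [add_pow, Finset.sum_mul]
      refine Finset.sum_congr rfl fun i _ => ?_
      rw [one_pow]
      ring
    simp_rw [this]
    refine Summable.norm (summable_sum fun i _ => Summable.mul_left _ ?_)
    exact (summable_norm_pow_mul_geometric_of_norm_lt_one i hr).of_norm
  refine Summable.of_norm_bounded h1 fun n => ?_
  rw [norm_mul, norm_mul]
  refine mul_le_mul_of_nonneg_right ?_ (norm_nonneg _)
  have hn : (1 : ℝ) ≤ (n : ℝ) + 1 := by linarith [(Nat.cast_nonneg n : (0 : ℝ) ≤ n)]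
  have hp : 0 ≤ ((n : ℝ) + 1) ^ γ := Real.rpow_nonneg (by linarith) _
  rw [Complex.norm_real, Real.norm_of_nonneg hp, norm_pow]
  have : ‖(n : ℂ) + 1‖ = (n : ℝ) + 1 := by
    have := Complex.norm_natCast (n + 1)
    push_cast at this
    exact this
  rw [this, ← Real.rpow_natCast]
  exact Real.rpow_le_rpow_of_exponent_le hn hk

/-- `K_(γ)` is a non-negative definite kernel; hence `RKHS.OfKernel (powerKernel γ)` is a
reproducing kernel Hilbert space with this kernel. -/
theorem powerKernel_posSemidef (γ : ℝ) : (powerKernel γ).PosSemidef := by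
  have htfae := RKHS.posSemidef_tfae (K := powerKernel γ)
  refine Iff.mpr (htfae.out 0 2) ?_
  refine ⟨?_, fun v => ?_⟩
  · refine Matrix.IsHermitian.ext fun z w => ?_
    rw [powerKernel, Matrix.of_apply, Matrix.of_apply, star_smul]
    congr 1
    · rw [← starRingEnd_apply, Complex.conj_tsum]
      refine tsum_congr fun n => ?_
      simp [mul_comm]
    · exact star_one (ℂ →L[ℂ] ℂ)
  · set t : ℕ → ℂ := fun n => ∑ x ∈ v.support, conj (x : ℂ) ^ n * v x with ht
    have key : HasSum (fun n : ℕ => ((((n : ℝ) + 1) ^ γ : ℝ) : ℂ) * (conj (t n) * t n))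
        (∑ x ∈ v.support, ∑ x' ∈ v.support, inner ℂ (powerKernel γ x' x (v x)) (v x')) := by
      have hn : ∀ n : ℕ, ((((n : ℝ) + 1) ^ γ : ℝ) : ℂ) * (conj (t n) * t n) =
          ∑ x ∈ v.support, ∑ x' ∈ v.support,
            conj (((((n : ℝ) + 1) ^ γ : ℝ) : ℂ) * ((x' : ℂ) * conj (x : ℂ)) ^ n * v x) * v x' := by
        intro n
        rw [ht, map_sum, Finset.sum_mul_sum, Finset.mul_sum]
        refine Finset.sum_congr rfl fun x _ => ?_
        rw [Finset.mul_sum]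
        refine Finset.sum_congr rfl fun x' _ => ?_
        simp only [map_mul, map_pow, Complex.conj_conj, Complex.conj_ofReal]
        ring
      simp_rw [hn]
      refine hasSum_sum fun x _ => hasSum_sum fun x' _ => ?_
      have hi : inner ℂ (powerKernel γ x' x (v x)) (v x') =
          conj ((∑' n : ℕ, ((((n : ℝ) + 1) ^ γ : ℝ) : ℂ) * ((x' : ℂ) * conj (x : ℂ)) ^ n) * v x) *
            v x' := by
        rw [RCLike.inner_apply, mul_comm]
        rfl
      rw [hi]
      exact (((powerKernel_summable γ x' x).hasSum.mul_right (v x)).map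
        (starRingEnd ℂ) Complex.continuous_conj).mul_right (v x')
    refine (Complex.hasSum_re key).nonneg fun n => ?_
    rw [← Complex.normSq_eq_conj_mul_self, ← Complex.ofReal_mul, Complex.ofReal_re]
    exact mul_nonneg (Real.rpow_nonneg (by positivity) _) (Complex.normSq_nonneg _)

/-- The disc automorphism `φ_{θ,a}(z) = e^{iθ} (z - a) / (1 - ā z)`, for `‖a‖ < 1`. -/
def moebius (θ : ℝ) (a z : ℂ) : ℂ :=
  Complex.exp (θ * Complex.I) * ((z - a) / (1 - conj a * z))

section Operators

variable {H : Type*} [NormedAddCommGroup H] [InnerProductSpace ℂ H] [CompleteSpace H]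

/-- The operator `φ_{θ,a}(T)` given, for `‖a‖ < 1` and `σ(T)` in the closed unit disc, by the
holomorphic functional calculus, `(2πi)⁻¹ ∮ φ_{θ,a}(z) (z - T)⁻¹ dz`. The circle of integration has
radius `R = 2 / (1 + ‖a‖)`; as `1 < R` and `‖a‖ R < 1`, it surrounds `σ(T)`, and `φ_{θ,a}` is
holomorphic in a neighbourhood of the closed disc that it bounds. -/
def moebiusApply (θ : ℝ) (a : ℂ) (T : H →L[ℂ] H) : H →L[ℂ] H :=
  (2 * Real.pi * Complex.I : ℂ)⁻¹ •
    ∮ z in C(0, 2 / (1 + ‖a‖)), moebius θ a z • resolvent T z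

/-- Similarity of bounded operators. -/
def AreSimilar (T S : H →L[ℂ] H) : Prop :=
  ∃ L : H ≃L[ℂ] H, (L : H →L[ℂ] H) ∘L T ∘L (L.symm : H →L[ℂ] H) = S

/-- Unitary equivalence of bounded operators. -/
def AreUnitarilyEquivalent (T S : H →L[ℂ] H) : Prop :=
  ∃ U : H ≃ₗᵢ[ℂ] H, ∀ x, U (T (U.symm x)) = S x

/-- `σ(T)` lies in the closed unit disc and `φ(T)` is unitarily equivalent to `T` for every `φ` in
the Möbius group. -/
def IsHomogeneousOperator (T : H →L[ℂ] H) : Prop :=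
  spectrum ℂ T ⊆ Metric.closedBall 0 1 ∧
    ∀ (θ : ℝ) (a : ℂ), ‖a‖ < 1 → AreUnitarilyEquivalent (moebiusApply θ a T) T

/-- `σ(T)` lies in the closed unit disc and `φ(T)` is similar to `T` for every `φ` in the Möbius
group. -/
def IsWeaklyHomogeneousOperator (T : H →L[ℂ] H) : Prop :=
  spectrum ℂ T ⊆ Metric.closedBall 0 1 ∧
    ∀ (θ : ℝ) (a : ℂ), ‖a‖ < 1 → AreSimilar (moebiusApply θ a T) T

/-- `T` is similar to some homogeneous operator. -/
def IsSimilarToHomogeneous (T : H →L[ℂ] H) : Prop :=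
  ∃ S : H →L[ℂ] H, IsHomogeneousOperator S ∧ AreSimilar T S

/-- The Cowen–Douglas class `B_k(Ω)`, for a positive integer `k` and a bounded domain `Ω`. -/
structure IsCowenDouglas (k : ℕ) (Ω : Set ℂ) (T : H →L[ℂ] H) : Prop where
  finrank_ker : ∀ w ∈ Ω, Module.finrank ℂ (T - w • ContinuousLinearMap.id ℂ H).ker = k
  isClosed_range : ∀ w ∈ Ω, IsClosed (Set.range (T - w • ContinuousLinearMap.id ℂ H))
  dense_span : (⨆ w ∈ Ω, (T - w • ContinuousLinearMap.id ℂ H).ker).topologicalClosure = ⊤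

/-- `M` is the operator `M_z` of multiplication by the coordinate function on a reproducing kernel
Hilbert space of functions on the unit disc. -/
def IsMulCoord [RKHS ℂ H Complex.UnitDisc ℂ] (M : H →L[ℂ] H) : Prop :=
  ∀ (f : H) (z : Complex.UnitDisc), (M f) z = (z : ℂ) * f z

end Operators

end

/-! ### Unitary equivalence from equality of Gram matrices. -/

section GramMatrix

variable {E F : Type*} [NormedAddCommGroup E] [InnerProductSpace ℂ E]
  [NormedAddCommGroup F] [InnerProductSpace ℂ F]

/-! All spaces are read in one Hilbert space with a basis `b` and a positive weight `s`: a vector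
with coordinates `x n` stands for the function `∑ s n * x n * z ^ n`, evaluation at `z` is the inner
product with `kerVec b s z`, and `M_z` is a weighted shift `W`. The kernel vectors are total,
`W.adjoint` multiplies `kerVec b s z` by `conj z`, and its eigenspaces in the disc are lines.
`moebiusApply_mul` turns the contour integral into an algebraic relation, so an intertwining of
`φ(W.adjoint)` with `W.adjoint` can be checked on kernel vectors (`IsCoordShift.intertwining`).

Weak homogeneity: the similarity is the adjoint of `f ↦ f ∘ φ`, so only boundedness of composition
is at issue (`hasBoundedComposition_powerWeight`). For `γ > -1` the norm is equivalent to that of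
the kernel `(1 - z w̄) ^ (-λ)` with `λ = γ + 1`. There `f ↦ j · (f ∘ φ)` is unitary
(`exists_unitary_binomialWeight`), and `j⁻¹` is a bounded multiplier. Lower `γ` are reached in steps
of 2, since differentiation passes from weight `γ` to weight `γ + 2` and `(f ∘ φ)' = φ' · (f' ∘ φ)`.
The same equivalence of norms makes `W.adjoint` similar to a homogeneous operator when `γ > -1`.

Failure for `γ ≤ -1`: if `L` carries `W.adjoint` to a homogeneous operator, the unitaries given by
homogeneity carry the eigenlines at `0` and `1/2` to those at `r` and `t = (1 + 2r)/(2 + r)`,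
preserving their angle. Yet for suitable `r` near `1` the vectors `k_r` and `k_t` are relatively as
close as desired (`exists_kerVec_close`), and a bounded invertible `L` cannot undo this. -/

theorem denseRange_linearCombination {ι : Type*} {u : ι → E}
    (hu : (Submodule.span ℂ (Set.range u)).topologicalClosure = ⊤) :
    DenseRange (Finsupp.linearCombination ℂ u) := by
  have h : Set.range (Finsupp.linearCombination ℂ u) = (Submodule.span ℂ (Set.range u) : Set E) := by
    rw [← Finsupp.range_linearCombination]; rfl
  rw [DenseRange, h]
  exact Submodule.dense_iff_topologicalClosure_eq_top.2 hu

/-- Two total families with the same Gram matrix are unitarily equivalent. -/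
theorem exists_linearIsometryEquiv_of_inner_eq {ι : Type*} [CompleteSpace E] [CompleteSpace F]
    {u : ι → E} {v : ι → F}
    (hu : (Submodule.span ℂ (Set.range u)).topologicalClosure = ⊤)
    (hv : (Submodule.span ℂ (Set.range v)).topologicalClosure = ⊤)
    (h : ∀ i j, inner ℂ (u i) (u j) = inner ℂ (v i) (v j)) :
    ∃ U : E ≃ₗᵢ[ℂ] F, ∀ i, U (u i) = v i := by
  have hnorm : ∀ x : ι →₀ ℂ, ‖Finsupp.linearCombination ℂ v x‖ =
      ‖Finsupp.linearCombination ℂ u x‖ := by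
    intro x
    have : inner ℂ (Finsupp.linearCombination ℂ v x) (Finsupp.linearCombination ℂ v x) =
        inner ℂ (Finsupp.linearCombination ℂ u x) (Finsupp.linearCombination ℂ u x) := by
      simp only [Finsupp.linearCombination_apply, Finsupp.sum_inner, Finsupp.inner_sum,
        inner_smul_left, inner_smul_right, h]
    rw [inner_self_eq_norm_sq_to_K, inner_self_eq_norm_sq_to_K] at this
    have h2 : ‖Finsupp.linearCombination ℂ v x‖ ^ 2 = ‖Finsupp.linearCombination ℂ u x‖ ^ 2 := by
      exact_mod_cast this
    exact (sq_eq_sq₀ (norm_nonneg _) (norm_nonneg _)).1 h2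
  have hA := denseRange_linearCombination hu
  have hB := denseRange_linearCombination hv
  have hu1 : ∀ i, Finsupp.linearCombination ℂ u (Finsupp.single i 1) = u i := by simp
  have hv1 : ∀ i, Finsupp.linearCombination ℂ v (Finsupp.single i 1) = v i := by simp
  generalize Finsupp.linearCombination ℂ u = A at *
  generalize Finsupp.linearCombination ℂ v = B at *
  refine ⟨(LinearEquiv.refl ℂ (ι →₀ ℂ)).extendOfIsometry A B hA hB hnorm, fun i => ?_⟩
  rw [← hu1, ← hv1]
  exact LinearEquiv.extendOfIsometry_eq (LinearEquiv.refl ℂ (ι →₀ ℂ)) A B hA hB hnorm _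

end GramMatrix

/-! ### The contour integral of the resolvent. -/

section FunctionalCalculus

theorem norm_lt_of_sphere_lt {a z : ℂ} (ha : ‖a‖ < 1) (hz : ‖z‖ ≤ 2 / (1 + ‖a‖)) :
    ‖conj a * z‖ < 1 := by
  have h0 := norm_nonneg a
  rw [norm_mul, RCLike.norm_conj]
  calc ‖a‖ * ‖z‖ ≤ ‖a‖ * (2 / (1 + ‖a‖)) := by gcongr
    _ = 2 * ‖a‖ / (1 + ‖a‖) := by ring
    _ < 1 := by rw [div_lt_one (by linarith)]; linarith

theorem one_sub_ne_zero_of_norm_lt_one {z : ℂ} (hz : ‖z‖ < 1) : 1 - z ≠ 0 := by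
  intro h
  rw [sub_eq_zero] at h
  rw [← h] at hz
  simp at hz

variable {A : Type*} [NormedRing A] [NormedAlgebra ℂ A] [CompleteSpace A]

/-- By Cauchy's theorem on annuli the radius may be enlarged to any `S`. On the large circle the
resolvent differs from `z⁻¹` by `z⁻¹ • (T * resolvent T z)`, which is `o(1/S)`, so the integral is
within every `ε` of that of `z⁻¹`. -/
theorem circleIntegral_resolvent (T : A) {R : ℝ} (hR0 : 0 < R)
    (hR : ∀ z ∈ spectrum ℂ T, ‖z‖ < R) :
    ∮ z in C(0, R), resolvent T z = (2 * Real.pi * Complex.I : ℂ) • (1 : A) := by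
  have hres : ∀ z : ℂ, R ≤ ‖z‖ → z ∈ resolventSet ℂ T := by
    intro z hz
    by_contra h
    exact absurd (hR z h) (not_lt.2 hz)
  have hd : ∀ z : ℂ, R ≤ ‖z‖ → DifferentiableAt ℂ (resolvent T) z := fun z hz =>
    (spectrum.hasDerivAt_resolvent_const_left (hres z hz)).differentiableAt
  have hS : ∀ S : ℝ, R ≤ S →
      ∮ z in C(0, S), resolvent T z = ∮ z in C(0, R), resolvent T z := by
    intro S hS
    refine Complex.circleIntegral_eq_of_differentiable_on_annulus_off_countable hR0 hS
      Set.countable_empty ?_ ?_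
    · intro z hz
      refine (hd z ?_).continuousAt.continuousWithinAt
      simpa using hz.2
    · intro z hz
      refine hd z ?_
      have := hz.1.2
      simp only [Metric.mem_closedBall, dist_zero_right, not_le] at this
      exact this.le
  have hlim : Filter.Tendsto (fun z : ℂ => T * resolvent T z) (Bornology.cobounded ℂ) (nhds 0) := by
    simpa using (spectrum.resolvent_tendsto_cobounded (𝕜 := ℂ) T).const_mul T
  rw [← sub_eq_zero, ← norm_le_zero_iff]
  refine le_of_forall_pos_le_add fun ε hε => ?_
  rw [zero_add]
  have hδ : 0 < ε / (2 * Real.pi) := by positivity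
  have h1 := (hlim.eventually (Metric.ball_mem_nhds 0 hδ))
  rw [Filter.Eventually, ← Metric.comap_dist_right_atTop 0] at h1
  obtain ⟨s, hs, hs'⟩ := h1
  obtain ⟨m, hm⟩ := Filter.mem_atTop_sets.1 hs
  set S := max m R with hSdef
  have hS0 : 0 < S := lt_of_lt_of_le hR0 (le_max_right _ _)
  have hbound : ∀ z ∈ Metric.sphere (0 : ℂ) S,
      ‖resolvent T z - z⁻¹ • (1 : A)‖ ≤ ε / (2 * Real.pi) / S := by
    intro z hz
    have hz' : ‖z‖ = S := by simpa using hz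
    have hz0 : z ≠ 0 := by
      rw [← norm_pos_iff, hz']; exact hS0
    have hb : ‖T * resolvent T z‖ < ε / (2 * Real.pi) := by
      have : z ∈ (fun y : ℂ => dist y 0) ⁻¹' s := hm _ (by
        change m ≤ dist z 0
        rw [dist_zero_right, hz']
        exact le_max_left _ _)
      simpa using hs' this
    have hunit : (algebraMap ℂ A z - T) * resolvent T z = 1 := by
      have := hres z (by rw [hz']; exact le_max_right _ _)
      rw [resolvent]
      exact Ring.mul_inverse_cancel _ this
    have heq : resolvent T z - z⁻¹ • (1 : A) = z⁻¹ • (T * resolvent T z) := by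
      have : T * resolvent T z = z • resolvent T z - 1 := by
        rw [← hunit, sub_mul, ← Algebra.smul_def]
        abel
      rw [this, smul_sub, smul_smul, inv_mul_cancel₀ hz0, one_smul]
    rw [heq, norm_smul, norm_inv, hz', div_eq_inv_mul _ S]
    gcongr
  have hint : ∮ z in C(0, S), z⁻¹ • (1 : A) = (2 * Real.pi * Complex.I : ℂ) • (1 : A) := by
    rw [circleIntegral.integral_smul_const]
    congr 1
    have := circleIntegral.integral_sub_center_inv 0 hS0.ne'
    simpa using this
  rw [← hS S (le_max_right _ _), ← hint, ← circleIntegral.integral_sub]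
  · calc _ ≤ 2 * Real.pi * S * (ε / (2 * Real.pi) / S) :=
        circleIntegral.norm_integral_le_of_norm_le_const hS0.le hbound
      _ = ε := by field_simp
  · refine ContinuousOn.circleIntegrable hS0.le fun z hz => ?_
    refine (hd z ?_).continuousAt.continuousWithinAt
    have hz' : ‖z‖ = S := by simpa using hz
    rw [hz']; exact le_max_right _ _
  · refine ContinuousOn.circleIntegrable hS0.le fun z hz => ?_
    refine ContinuousAt.continuousWithinAt ?_
    have hz' : ‖z‖ = S := by simpa using hz
    have hz0 : z ≠ 0 := by
      rw [← norm_pos_iff, hz']; exact hS0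
    exact (continuousAt_inv₀ hz0).smul continuousAt_const

theorem isUnit_one_sub_smul_of_spectrum_subset {A : Type*} [NormedRing A] [NormedAlgebra ℂ A]
    {T : A} (hT : spectrum ℂ T ⊆ Metric.closedBall 0 1)
    {a : ℂ} (ha : ‖a‖ < 1) : IsUnit (1 - a • T) := by
  by_cases h0 : a = 0
  · simp [h0]
  have h1 : a⁻¹ ∈ resolventSet ℂ T := by
    by_contra h
    have := hT h
    rw [mem_closedBall_zero_iff, norm_inv] at this
    have h2 := (one_lt_inv₀ (norm_pos_iff.2 h0)).2 ha
    linarith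
  rw [spectrum.mem_resolventSet_iff] at h1
  have h2 : 1 - a • T = algebraMap ℂ A a * (algebraMap ℂ A a⁻¹ - T) := by
    rw [mul_sub, ← map_mul, mul_inv_cancel₀ h0, map_one, Algebra.smul_def]
  rw [h2]
  exact ((isUnit_iff_ne_zero.2 h0).map (algebraMap ℂ A)).mul h1

end FunctionalCalculus

/-! ### Möbius functions of an operator without the integral. -/

section MoebiusApply

variable {H : Type*} [NormedAddCommGroup H] [InnerProductSpace ℂ H] [CompleteSpace H]

/-- A partial fraction splits the integrand into a scalar function holomorphic inside the circle
times a fixed operator, whose integral vanishes, plus `P * resolvent T z` with `P` the expected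
fraction in `T`. -/
theorem moebiusApply_mul (θ : ℝ) {a : ℂ} (ha : ‖a‖ < 1) {T : H →L[ℂ] H}
    (hT : spectrum ℂ T ⊆ Metric.closedBall 0 1) :
    moebiusApply θ a T * (1 - conj a • T) = Complex.exp (θ * Complex.I) • (T - a • 1) := by
  have hR1 : 1 < 2 / (1 + ‖a‖) := by
    rw [lt_div_iff₀ (by positivity)]; linarith
  have hR0 : 0 < 2 / (1 + ‖a‖) := by linarith
  have hσ : ∀ z ∈ spectrum ℂ T, ‖z‖ < 2 / (1 + ‖a‖) := by
    intro z hz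
    have := hT hz
    rw [mem_closedBall_zero_iff] at this
    linarith
  set D : H →L[ℂ] H := 1 - conj a • T with hD
  have hDu : IsUnit D := isUnit_one_sub_smul_of_spectrum_subset hT (by rwa [RCLike.norm_conj])
  obtain ⟨N, hDN, hND⟩ := isUnit_iff_exists.1 hDu
  set c : ℂ := Complex.exp (θ * Complex.I) with hc
  set P : H →L[ℂ] H := c • ((T - a • 1) * N) with hP
  have hne : ∀ z ∈ Metric.closedBall (0 : ℂ) (2 / (1 + ‖a‖)), 1 - conj a * z ≠ 0 := by
    intro z hz
    exact one_sub_ne_zero_of_norm_lt_one (norm_lt_of_sphere_lt ha (by simpa using hz))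
  have hpt : ∀ z ∈ Metric.sphere (0 : ℂ) (2 / (1 + ‖a‖)), moebius θ a z • resolvent T z =
      (1 - conj a * z)⁻¹ • ((c * (1 - conj a * a)) • N) + P * resolvent T z := by
    intro z hz
    have hz1 := hne z (Metric.sphere_subset_closedBall hz)
    have hu : IsUnit (algebraMap ℂ (H →L[ℂ] H) z - T) := by
      by_contra h
      have := hσ z h
      rw [mem_sphere_zero_iff_norm] at hz
      linarith
    have hr : (algebraMap ℂ (H →L[ℂ] H) z - T) * resolvent T z = 1 := Ring.mul_inverse_cancel _ hu
    have hcomm : Commute (T - a • 1) D := by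
      rw [hD]
      refine Commute.sub_left (Commute.sub_right (Commute.one_right _) ?_)
        (Commute.smul_left (Commute.one_left _) _)
      exact (Commute.refl T).smul_right _
    have hcN : (T - a • 1) * N = N * (T - a • 1) := by
      calc (T - a • 1) * N = N * D * ((T - a • 1) * N) := by rw [hND, one_mul]
        _ = N * (D * (T - a • 1)) * N := by simp only [mul_assoc]
        _ = N * ((T - a • 1) * D) * N := by rw [hcomm.eq]
        _ = N * (T - a • 1) := by rw [mul_assoc, mul_assoc, hDN, mul_one]
    -- multiply by `D` on the left
    have key : (z - a) • D = (1 - conj a * z) • (T - a • 1) +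
        (1 - conj a * a) • (algebraMap ℂ (H →L[ℂ] H) z - T) := by
      rw [hD, Algebra.algebraMap_eq_smul_one]
      module
    have key2 : ((z - a) / (1 - conj a * z)) • resolvent T z =
        (1 - conj a * z)⁻¹ • ((1 - conj a * a) • N) + (T - a • 1) * N * resolvent T z := by
      calc ((z - a) / (1 - conj a * z)) • resolvent T z
          = (1 - conj a * z)⁻¹ • (N * ((z - a) • D) * resolvent T z) := by
            rw [mul_smul_comm, hND, smul_mul_assoc, one_mul, smul_smul, div_eq_inv_mul]
        _ = (1 - conj a * z)⁻¹ • ((1 - conj a * z) • (N * (T - a • 1) * resolvent T z) +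
              (1 - conj a * a) • (N * ((algebraMap ℂ (H →L[ℂ] H) z - T) * resolvent T z))) := by
            rw [key]
            simp only [mul_add, add_mul, mul_smul_comm, smul_mul_assoc, mul_assoc]
        _ = _ := by
            rw [hr, mul_one, smul_add, smul_smul _ (1 - conj a * z), inv_mul_cancel₀ hz1, one_smul,
              hcN, add_comm]
    rw [moebius, mul_smul, key2, hP, smul_add, smul_comm c, smul_smul c, smul_mul_assoc]
  have hint1 : ∮ z in C(0, 2 / (1 + ‖a‖)), (1 - conj a * z)⁻¹ • ((c * (1 - conj a * a)) • N) = 0 := by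
    rw [circleIntegral.integral_smul_const]
    convert zero_smul ℂ _
    refine Complex.circleIntegral_eq_zero_of_differentiable_on_off_countable hR0.le
      Set.countable_empty ?_ ?_
    · refine ContinuousOn.inv₀ (by fun_prop) hne
    · intro z hz
      refine DifferentiableAt.inv (by fun_prop) (hne z (Metric.ball_subset_closedBall hz.1))
  have hcr : ContinuousOn (fun z => resolvent T z) (Metric.sphere (0 : ℂ) (2 / (1 + ‖a‖))) := by
    intro z hz
    refine (spectrum.hasDerivAt_resolvent_const_left (a := T) (k := z)
      ?_).continuousAt.continuousWithinAt
    by_contra h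
    have := hσ z h
    rw [mem_sphere_zero_iff_norm] at hz
    linarith
  have hint2 : ∮ z in C(0, 2 / (1 + ‖a‖)), P * resolvent T z =
      (2 * Real.pi * Complex.I : ℂ) • P := by
    have h1 := ContinuousLinearMap.intervalIntegral_comp_comm (μ := MeasureTheory.volume)
      (a := 0) (b := 2 * Real.pi)
      (ContinuousLinearMap.mul ℂ (H →L[ℂ] H) P)
      (ContinuousOn.circleIntegrable hR0.le hcr).out
    have h2 := circleIntegral_resolvent T hR0 hσ
    rw [circleIntegral] at h2 ⊢
    rw [h2] at h1
    simpa using h1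
  have hval : moebiusApply θ a T = P := by
    rw [moebiusApply, circleIntegral.integral_congr hR0.le hpt, circleIntegral.integral_add, hint1,
      hint2, zero_add, smul_smul, inv_mul_cancel₀ Complex.two_pi_I_ne_zero, one_smul]
    · refine ContinuousOn.circleIntegrable hR0.le (ContinuousOn.smul (ContinuousOn.inv₀ (by fun_prop)
        fun z hz => hne z (Metric.sphere_subset_closedBall hz)) continuousOn_const)
    · exact ContinuousOn.circleIntegrable hR0.le (continuousOn_const.mul hcr)
  rw [hval, hP, smul_mul_assoc, mul_assoc, hND, mul_one]

/-- Cancelling the invertible factor `1 - conj a • T` leaves a hypothesis polynomial in `T`, which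
can be tested on eigenvectors. -/
theorem comp_moebiusApply_eq {θ : ℝ} {a : ℂ} (ha : ‖a‖ < 1) {T : H →L[ℂ] H}
    (hT : spectrum ℂ T ⊆ Metric.closedBall 0 1) {L : H →L[ℂ] H}
    (h : T * L * (1 - conj a • T) = Complex.exp (θ * Complex.I) • (L * (T - a • 1))) :
    L * moebiusApply θ a T = T * L := by
  have hDu : IsUnit (1 - conj a • T) :=
    isUnit_one_sub_smul_of_spectrum_subset hT (by rwa [RCLike.norm_conj])
  refine hDu.mul_right_cancel ?_
  rw [h, mul_assoc, moebiusApply_mul θ ha hT, mul_smul_comm]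

theorem areSimilar_moebiusApply {θ : ℝ} {a : ℂ} (ha : ‖a‖ < 1) {T : H →L[ℂ] H}
    (hT : spectrum ℂ T ⊆ Metric.closedBall 0 1) (L : H ≃L[ℂ] H)
    (h : T * (L : H →L[ℂ] H) * (1 - conj a • T) =
      Complex.exp (θ * Complex.I) • ((L : H →L[ℂ] H) * (T - a • 1))) :
    AreSimilar (moebiusApply θ a T) T := by
  refine ⟨L, ?_⟩
  have := comp_moebiusApply_eq ha hT h
  ext x
  have := congrArg (fun S : H →L[ℂ] H => S (L.symm x)) this
  simpa using this

theorem areUnitarilyEquivalent_moebiusApply {θ : ℝ} {a : ℂ} (ha : ‖a‖ < 1) {T : H →L[ℂ] H}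
    (hT : spectrum ℂ T ⊆ Metric.closedBall 0 1) (U : H ≃ₗᵢ[ℂ] H)
    (h : T * (U.toContinuousLinearEquiv : H →L[ℂ] H) * (1 - conj a • T) =
      Complex.exp (θ * Complex.I) • ((U.toContinuousLinearEquiv : H →L[ℂ] H) * (T - a • 1))) :
    AreUnitarilyEquivalent (moebiusApply θ a T) T := by
  refine ⟨U, fun x => ?_⟩
  have := comp_moebiusApply_eq ha hT h
  have := congrArg (fun S : H →L[ℂ] H => S (U.symm x)) this
  simpa using this

/-- The functional calculus acts on eigenvectors by evaluation. -/
theorem moebiusApply_apply_of_eigenvector {θ : ℝ} {a : ℂ} (ha : ‖a‖ < 1) {T : H →L[ℂ] H}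
    (hT : spectrum ℂ T ⊆ Metric.closedBall 0 1) {w : ℂ} (hw : ‖w‖ < 1) {x : H} (hx : T x = w • x) :
    moebiusApply θ a T x = moebius θ a w • x := by
  have h := congrArg (fun S : H →L[ℂ] H => S x) (moebiusApply_mul θ ha hT)
  have hne : 1 - conj a * w ≠ 0 := by
    refine one_sub_ne_zero_of_norm_lt_one ?_
    rw [norm_mul, RCLike.norm_conj]
    nlinarith [norm_nonneg a, norm_nonneg w]
  simp only [mul_apply_eq_comp, FunLike.coe_sub, Pi.sub_apply,
    one_apply_eq_self, FunLike.coe_smul, Pi.smul_apply, hx] at h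
  have h1 : x - conj a • w • x = (1 - conj a * w) • x := by module
  have h2 : w • x - a • x = (w - a) • x := by module
  rw [h1, h2, map_smul] at h
  rw [moebius, mul_smul, div_eq_inv_mul, mul_smul, smul_comm, ← h, smul_smul, inv_mul_cancel₀ hne,
    one_smul]

end MoebiusApply

/-! ### Weighted shifts in Hilbert basis coordinates. -/

section Coordinates

variable {E : Type*} [NormedAddCommGroup E] [InnerProductSpace ℂ E] (b : HilbertBasis ℕ ℂ E)

theorem HilbertBasis.ext_repr {x y : E} (h : ∀ n, b.repr x n = b.repr y n) : x = y :=
  b.repr.injective (lp.ext (funext h))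

theorem HilbertBasis.hasSum_norm_sq (x : E) : HasSum (fun n => ‖b.repr x n‖ ^ 2) (‖x‖ ^ 2) := by
  have := lp.hasSum_norm (p := 2) (by norm_num) (b.repr x)
  simpa using this

theorem HilbertBasis.exists_repr_eq {c : ℕ → ℂ} (hc : Summable fun n => ‖c n‖ ^ 2) :
    ∃ x : E, ∀ n, b.repr x n = c n := by
  have hm : Memℓp c 2 := (memℓp_gen_iff (by norm_num)).2 (by simpa using hc)
  exact ⟨b.repr.symm ⟨c, hm⟩, fun n => by simp⟩

/-- `S` is the weighted shift `b n ↦ u n • b (n + k)`. -/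
structure IsShift (k : ℕ) (u : ℕ → ℝ) (S : E →L[ℂ] E) : Prop where
  repr_add : ∀ x n, b.repr (S x) (n + k) = u n * b.repr x n
  repr_of_lt : ∀ x n, n < k → b.repr (S x) n = 0

variable {b}

theorem IsShift.hasSum_norm_sq {k : ℕ} {u : ℕ → ℝ} {S : E →L[ℂ] E} (hS : IsShift b k u S) (x : E) :
    HasSum (fun n => ‖u n * b.repr x n‖ ^ 2) (‖S x‖ ^ 2) := by
  have h := (hasSum_nat_add_iff' k).2 (b.hasSum_norm_sq (S x))
  rw [Finset.sum_eq_zero, sub_zero] at h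
  · simpa only [hS.repr_add] using h
  · intro n hn
    rw [hS.repr_of_lt x n (Finset.mem_range.1 hn)]
    simp

theorem IsShift.norm_apply_le {k : ℕ} {u : ℕ → ℝ} {S : E →L[ℂ] E} (hS : IsShift b k u S) {C : ℝ}
    (hC : ∀ n, |u n| ≤ C) (x : E) : ‖S x‖ ≤ C * ‖x‖ := by
  have hC0 : 0 ≤ C := (abs_nonneg _).trans (hC 0)
  refine (sq_le_sq₀ (norm_nonneg _) (by positivity)).1 ?_
  rw [mul_pow]
  refine hasSum_le (fun n => ?_) (hS.hasSum_norm_sq x) ((b.hasSum_norm_sq x).mul_left (C ^ 2))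
  rw [norm_mul, mul_pow, Complex.norm_real, Real.norm_eq_abs]
  gcongr
  exact hC n

theorem IsShift.norm_le {k : ℕ} {u : ℕ → ℝ} {S : E →L[ℂ] E} (hS : IsShift b k u S) {C : ℝ}
    (hC : ∀ n, |u n| ≤ C) : ‖S‖ ≤ C :=
  S.opNorm_le_bound ((abs_nonneg _).trans (hC 0)) (hS.norm_apply_le hC)

theorem IsShift.repr_adjoint [CompleteSpace E] {k : ℕ} {u : ℕ → ℝ} {S : E →L[ℂ] E}
    (hS : IsShift b k u S) (x : E) (n : ℕ) :
    b.repr (S.adjoint x) n = u n * b.repr x (n + k) := by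
  have hb : S (b n) = (u n : ℂ) • b (n + k) := by
    refine b.ext_repr fun m => ?_
    rw [map_smul, lp.coeFn_smul, Pi.smul_apply, b.repr_self, smul_eq_mul]
    rcases lt_or_ge m k with hm | hm
    · rw [hS.repr_of_lt _ _ hm, lp.single_apply_ne _ _ _ (by omega), mul_zero]
    · obtain ⟨m, rfl⟩ := Nat.exists_eq_add_of_le' hm
      rw [hS.repr_add, b.repr_self]
      by_cases h : m = n
      · subst h; simp
      · rw [lp.single_apply_ne _ _ _ h, lp.single_apply_ne _ _ _ (by omega), mul_zero, mul_zero]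
  rw [b.repr_apply_apply, b.repr_apply_apply, ContinuousLinearMap.adjoint_inner_right, hb,
    inner_smul_left, Complex.conj_ofReal]

variable (b)

theorem exists_isShift (k : ℕ) {u : ℕ → ℝ} {C : ℝ} (hC : ∀ n, |u n| ≤ C) :
    ∃ S : E →L[ℂ] E, IsShift b k u S := by
  have hC0 : 0 ≤ C := (abs_nonneg _).trans (hC 0)
  have hsum : ∀ x : E, Summable fun n => ‖(u n : ℂ) * b.repr x n‖ ^ 2 := by
    intro x
    refine Summable.of_nonneg_of_le (fun n => by positivity) (fun n => ?_)
      ((b.hasSum_norm_sq x).summable.mul_left (C ^ 2))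
    rw [norm_mul, mul_pow, Complex.norm_real, Real.norm_eq_abs]
    gcongr
    exact hC n
  have hex : ∀ x : E, ∃ y : E, ∀ n, b.repr y n =
      if k ≤ n then (u (n - k) : ℂ) * b.repr x (n - k) else 0 := by
    intro x
    refine b.exists_repr_eq ((summable_nat_add_iff k).1 ?_)
    simpa using hsum x
  choose f hf using hex
  let L : E →ₗ[ℂ] E :=
    { toFun := f
      map_add' := fun x y => by
        refine b.ext_repr fun n => ?_
        rw [map_add, lp.coeFn_add, Pi.add_apply, hf, hf, hf, map_add, lp.coeFn_add]
        split_ifs <;> simp [mul_add]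
      map_smul' := fun c x => by
        refine b.ext_repr fun n => ?_
        rw [map_smul, lp.coeFn_smul, Pi.smul_apply, hf, hf, map_smul, lp.coeFn_smul]
        split_ifs <;> simp [mul_left_comm] }
  have hL : ∀ x, ‖L x‖ ≤ C * ‖x‖ := by
    intro x
    refine (sq_le_sq₀ (norm_nonneg _) (by positivity)).1 ?_
    rw [mul_pow]
    have h := (hasSum_nat_add_iff' k).2 (b.hasSum_norm_sq (L x))
    rw [Finset.sum_eq_zero, sub_zero] at h
    · refine hasSum_le (fun n => ?_) h ((b.hasSum_norm_sq x).mul_left (C ^ 2))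
      change ‖b.repr (f x) (n + k)‖ ^ 2 ≤ _
      rw [hf, if_pos (by omega), Nat.add_sub_cancel, norm_mul, mul_pow, Complex.norm_real,
        Real.norm_eq_abs]
      gcongr
      exact hC n
    · intro n hn
      change ‖b.repr (f x) n‖ ^ 2 = 0
      rw [hf, if_neg (by simpa using hn)]
      simp
  refine ⟨L.mkContinuous C hL, fun x n => ?_, fun x n hn => ?_⟩
  · change b.repr (f x) (n + k) = _
    rw [hf, if_pos (by omega), Nat.add_sub_cancel]
  · change b.repr (f x) n = _
    rw [hf, if_neg (by omega)]

end Coordinates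

/-! ### Uniqueness and differentiation of power series on the disc. -/

section PowerSeries

theorem mem_eball_zero_one_iff {z : ℂ} : z ∈ Metric.eball (0 : ℂ) 1 ↔ ‖z‖ < 1 := by
  rw [← ENNReal.ofReal_one, Metric.eball_ofReal, mem_ball_zero_iff]

theorem hasFPowerSeriesOnBall_of_hasSum {c : ℕ → ℂ} {f : ℂ → ℂ}
    (h : ∀ z, ‖z‖ < 1 → HasSum (fun n => c n * z ^ n) (f z)) :
    HasFPowerSeriesOnBall f (FormalMultilinearSeries.ofScalars ℂ c) 0 1 := by
  refine ⟨?_, one_pos, fun {z} hz => ?_⟩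
  · refine le_of_forall_lt_imp_le_of_dense fun r hr => ?_
    lift r to NNReal using hr.ne_top
    have hr' : (r : ℝ) < 1 := by exact_mod_cast hr
    refine FormalMultilinearSeries.le_radius_of_tendsto (l := 0) _ ?_
    have h1 := (h (r : ℝ) (by simpa using hr')).summable.tendsto_atTop_zero.norm
    simpa using h1
  · have hz' : ‖z‖ < 1 := mem_eball_zero_one_iff.1 hz
    simpa [FormalMultilinearSeries.ofScalars, List.ofFn_const, mul_comm, zero_add] using h z hz'

theorem coeff_eq_of_hasSum {c d : ℕ → ℂ} {f : ℂ → ℂ}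
    (hc : ∀ z, ‖z‖ < 1 → HasSum (fun n => c n * z ^ n) (f z))
    (hd : ∀ z, ‖z‖ < 1 → HasSum (fun n => d n * z ^ n) (f z)) : c = d := by
  have := (hasFPowerSeriesOnBall_of_hasSum hc).hasFPowerSeriesAt.eq_formalMultilinearSeries
    (hasFPowerSeriesOnBall_of_hasSum hd).hasFPowerSeriesAt
  exact FormalMultilinearSeries.ofScalars_series_injective ℂ ℂ this

theorem hasDerivAt_of_hasSum {c : ℕ → ℂ} {f : ℂ → ℂ}
    (h : ∀ z, ‖z‖ < 1 → HasSum (fun n => c n * z ^ n) (f z)) {z : ℂ} (hz : ‖z‖ < 1) :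
    ∃ f', HasDerivAt f f' z ∧ HasSum (fun n : ℕ => (n + 1) * c (n + 1) * z ^ n) f' := by
  have hf := hasFPowerSeriesOnBall_of_hasSum h
  have hz' : z ∈ Metric.eball (0 : ℂ) 1 := mem_eball_zero_one_iff.2 hz
  have hd : DifferentiableAt ℂ f z := (hf.analyticAt_of_mem hz').differentiableAt
  refine ⟨deriv f z, hd.hasDerivAt, ?_⟩
  have h1 := hf.fderiv.hasSum hz'
  have h2 := h1.mapL (ContinuousLinearMap.apply ℂ ℂ (1 : ℂ))
  rw [zero_add] at h2
  simp only [ContinuousLinearMap.apply_apply, fderiv_apply_one_eq_deriv] at h2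
  convert! h2 using 2
  rename_i n
  have h3 : (fun _ : Fin n => z) = fun _ => z • (1 : ℂ) := by simp
  rw [h3, ContinuousMultilinearMap.map_smul_univ, FunLike.coe_smul, Pi.smul_apply,
    FormalMultilinearSeries.derivSeries_apply_diag]
  simp [FormalMultilinearSeries.ofScalars, List.ofFn_const]
  ring

end PowerSeries

/-! ### Weights of polynomially bounded variation. -/

section Weights

theorem summable_succ_pow_mul_geometric (k : ℕ) {r : ℝ} (h0 : 0 ≤ r) (h1 : r < 1) :
    Summable fun n : ℕ => ((n : ℝ) + 1) ^ k * r ^ n := by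
  have hg := summable_geometric_of_lt_one h0 h1
  have hk := summable_pow_mul_geometric_of_norm_lt_one (R := ℝ) k (r := r)
    (by rwa [Real.norm_of_nonneg h0])
  refine Summable.of_nonneg_of_le (fun n => by positivity) (fun n => ?_)
    ((hk.mul_left (2 ^ k)).add hg)
  have hrn : 0 ≤ r ^ n := pow_nonneg h0 n
  rcases Nat.eq_zero_or_pos n with rfl | hn
  · simp
  · have h1n : (1 : ℝ) ≤ n := by exact_mod_cast hn
    have : ((n : ℝ) + 1) ^ k ≤ 2 ^ k * (n : ℝ) ^ k := by
      rw [← mul_pow]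
      gcongr
      linarith
    nlinarith

/-- A positive weight whose ratios grow at most polynomially in the gap, in both directions. -/
structure IsTempered (s : ℕ → ℝ) : Prop where
  pos : ∀ n, 0 < s n
  bound : ∃ (C : ℝ) (κ : ℕ), ∀ m k : ℕ, s m ≤ C * ((k : ℝ) + 1) ^ κ * s (m + k) ∧
    s (m + k) ≤ C * ((k : ℝ) + 1) ^ κ * s m

/-- The two-sided bound exists for the sake of this stability: the shift of the inverse weight
provides a right inverse of the backward shift, and its adjoint is differentiation. -/
theorem IsTempered.inv {s : ℕ → ℝ} (hs : IsTempered s) : IsTempered fun n => (s n)⁻¹ := by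
  obtain ⟨C, κ, h⟩ := hs.bound
  refine ⟨fun n => inv_pos.2 (hs.pos n), C, κ, fun m k => ⟨?_, ?_⟩⟩
  · rw [← div_eq_mul_inv, inv_eq_one_div, div_le_div_iff₀ (hs.pos _) (hs.pos _), one_mul]
    exact (h m k).2
  · rw [← div_eq_mul_inv, inv_eq_one_div, div_le_div_iff₀ (hs.pos _) (hs.pos _), one_mul]
    exact (h m k).1

theorem IsTempered.ratio_le {s : ℕ → ℝ} (hs : IsTempered s) :
    ∃ (C : ℝ) (κ : ℕ), ∀ k m : ℕ, |s m / s (m + k)| ≤ C * ((k : ℝ) + 1) ^ κ := by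
  obtain ⟨C, κ, h⟩ := hs.bound
  refine ⟨C, κ, fun k m => ?_⟩
  rw [abs_of_pos (div_pos (hs.pos _) (hs.pos _)), div_le_iff₀ (hs.pos _)]
  exact (h m k).1

theorem IsTempered.summable_sq {s : ℕ → ℝ} (hs : IsTempered s) {r : ℝ} (h0 : 0 ≤ r) (h1 : r < 1) :
    Summable fun n : ℕ => s n ^ 2 * r ^ n := by
  obtain ⟨C, κ, h⟩ := hs.bound
  refine Summable.of_nonneg_of_le (fun n => by positivity) (fun n => ?_)
    ((summable_succ_pow_mul_geometric (2 * κ) h0 h1).mul_left ((C * s 0) ^ 2))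
  have h2 := (h 0 n).2
  rw [zero_add] at h2
  calc s n ^ 2 * r ^ n ≤ (C * ((n : ℝ) + 1) ^ κ * s 0) ^ 2 * r ^ n := by
        have := (hs.pos n).le
        gcongr
    _ = _ := by ring

end Weights

/-! ### Kernel vectors, the coordinate shift and its Cowen–Douglas property. -/

section KernelVectors

variable {E : Type*} [NormedAddCommGroup E] [InnerProductSpace ℂ E]

/-- The reproducing kernel vector at `w` of the space of power series in which `s n • z ^ n` is
identified with the basis vector `b n`. -/
noncomputable def kerVec (b : HilbertBasis ℕ ℂ E) (s : ℕ → ℝ) (w : ℂ) : E :=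
  ∑' n, ((s n : ℂ) * conj w ^ n) • b n

variable {b : HilbertBasis ℕ ℂ E} {s : ℕ → ℝ}

theorem repr_kerVec (hs : IsTempered s) {w : ℂ} (hw : ‖w‖ < 1) (n : ℕ) :
    b.repr (kerVec b s w) n = s n * conj w ^ n := by
  have hsum : Summable fun n => ‖(s n : ℂ) * conj w ^ n‖ ^ 2 := by
    have h1 : ‖w‖ ^ 2 < 1 := by nlinarith [norm_nonneg w]
    refine (hs.summable_sq (by positivity) h1).congr fun n => ?_
    rw [norm_mul, mul_pow, Complex.norm_real, norm_pow, RCLike.norm_conj, Real.norm_eq_abs, sq_abs]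
    ring
  obtain ⟨x, hx⟩ := b.exists_repr_eq hsum
  have : kerVec b s w = x := by
    have := (b.hasSum_repr x).tsum_eq
    simp only [hx] at this
    exact this
  rw [this, hx]

theorem hasSum_inner_kerVec (hs : IsTempered s) {z : ℂ} (hz : ‖z‖ < 1) (x : E) :
    HasSum (fun n => (s n * b.repr x n) * z ^ n) (inner ℂ (kerVec b s z) x) := by
  have h := lp.hasSum_inner (𝕜 := ℂ) (b.repr (kerVec b s z)) (b.repr x)
  rw [b.repr.inner_map_map] at h
  refine h.congr_fun fun n => ?_
  rw [repr_kerVec hs hz, RCLike.inner_apply]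
  simp
  ring

theorem hasSum_inner_kerVec_kerVec (hs : IsTempered s) {z w : ℂ} (hz : ‖z‖ < 1) (hw : ‖w‖ < 1) :
    HasSum (fun n => ((s n ^ 2 : ℝ) : ℂ) * (z * conj w) ^ n)
      (inner ℂ (kerVec b s z) (kerVec b s w)) := by
  refine (hasSum_inner_kerVec hs hz _).congr_fun fun n => ?_
  rw [repr_kerVec hs hw]
  push_cast
  ring

/-- The values on the disc determine the power series, hence the coordinates, as no `s n` vanishes.
Operator identities are therefore checked pointwise in `z`. -/
theorem ext_inner_kerVec (hs : IsTempered s) {x y : E}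
    (h : ∀ z : ℂ, ‖z‖ < 1 → inner ℂ (kerVec b s z) x = inner ℂ (kerVec b s z) y) : x = y := by
  refine b.ext_repr fun n => ?_
  have := congrFun (coeff_eq_of_hasSum (fun z hz => hasSum_inner_kerVec (b := b) hs hz x)
    (fun z hz => by rw [h z hz]; exact hasSum_inner_kerVec hs hz y)) n
  exact mul_left_cancel₀ (Complex.ofReal_ne_zero.2 (hs.pos n).ne') this

theorem topologicalClosure_span_kerVec [CompleteSpace E] (hs : IsTempered s) :
    (Submodule.span ℂ (Set.range fun z : Complex.UnitDisc => kerVec b s z)).topologicalClosure =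
      ⊤ := by
  rw [Submodule.topologicalClosure_eq_top_iff, Submodule.eq_bot_iff]
  intro x hx
  refine ext_inner_kerVec (b := b) hs fun z hz => ?_
  rw [inner_zero_right]
  exact (Submodule.mem_orthogonal _ _).1 hx _ (Submodule.subset_span ⟨Complex.UnitDisc.mk z hz, rfl⟩)

theorem IsShift.inner_kerVec (hs : IsTempered s) {k : ℕ} {S : E →L[ℂ] E}
    (hS : IsShift b k (fun n => s n / s (n + k)) S) {z : ℂ} (hz : ‖z‖ < 1) (x : E) :
    inner ℂ (kerVec b s z) (S x) = z ^ k * inner ℂ (kerVec b s z) x := by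
  have h1 := (hasSum_nat_add_iff' k).2 (hasSum_inner_kerVec (b := b) hs hz (S x))
  rw [Finset.sum_eq_zero, sub_zero] at h1
  · refine h1.unique (((hasSum_inner_kerVec hs hz x).mul_left (z ^ k)).congr_fun fun n => ?_)
    rw [hS.repr_add]
    have : (s (n + k) : ℂ) ≠ 0 := by exact_mod_cast (hs.pos _).ne'
    push_cast
    field_simp
    ring
  · intro n hn
    rw [hS.repr_of_lt x n (Finset.mem_range.1 hn)]
    simp

variable (b s) in
/-- `W` is multiplication by the coordinate on the space of power series with weight `s`. -/
def IsCoordShift (W : E →L[ℂ] E) : Prop := IsShift b 1 (fun n => s n / s (n + 1)) W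

variable (b) in
theorem exists_isCoordShift (hs : IsTempered s) : ∃ W : E →L[ℂ] E, IsCoordShift b s W := by
  obtain ⟨C, κ, h⟩ := hs.ratio_le
  exact exists_isShift b 1 (h 1)

theorem IsCoordShift.inner_kerVec (hs : IsTempered s) {W : E →L[ℂ] E} (hW : IsCoordShift b s W)
    {z : ℂ} (hz : ‖z‖ < 1) (x : E) :
    inner ℂ (kerVec b s z) (W x) = z * inner ℂ (kerVec b s z) x := by
  simpa using IsShift.inner_kerVec hs hW hz x

/-- The power `W ^ n` is multiplication by `z ^ n`, that is, the `n`-step shift with ratios `s m / s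
(m + n)`; bounding those directly avoids the exponential loss of `‖W‖ ^ n`. -/
theorem IsCoordShift.norm_pow_le (hs : IsTempered s) {W : E →L[ℂ] E} (hW : IsCoordShift b s W) :
    ∃ (C : ℝ) (κ : ℕ), ∀ n : ℕ, ‖W ^ n‖ ≤ C * ((n : ℝ) + 1) ^ κ := by
  obtain ⟨C, κ, h⟩ := hs.ratio_le
  refine ⟨C, κ, fun n => ?_⟩
  have hpow : ∀ z : ℂ, ‖z‖ < 1 → ∀ x, inner ℂ (kerVec b s z) ((W ^ n) x) =
      z ^ n * inner ℂ (kerVec b s z) x := by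
    intro z hz
    induction n with
    | zero => simp
    | succ n ih =>
      intro x
      rw [pow_succ', mul_apply_eq_comp, hW.inner_kerVec hs hz, ih, pow_succ']
      ring
  obtain ⟨S, hS⟩ := exists_isShift b n (h n)
  have : W ^ n = S := by
    ext x
    exact ext_inner_kerVec (b := b) hs fun z hz => by rw [hpow z hz, hS.inner_kerVec hs hz]
  rw [this]
  exact hS.norm_le (h n)

theorem IsCoordShift.spectrum_subset [CompleteSpace E] (hs : IsTempered s) {W : E →L[ℂ] E}
    (hW : IsCoordShift b s W) : spectrum ℂ W ⊆ Metric.closedBall 0 1 := by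
  obtain ⟨C, κ, h⟩ := hW.norm_pow_le hs
  intro z hz
  rw [mem_closedBall_zero_iff]
  by_contra! hz1
  have h1 : ∀ n : ℕ, 1 ≤ ‖(1 : E →L[ℂ] E)‖ * C * (((n : ℝ) + 1) ^ κ * (‖z‖⁻¹) ^ n) := by
    intro n
    have h2 := (spectrum.norm_le_norm_mul_of_mem (spectrum.pow_mem_pow W n hz)).trans
      (mul_le_mul_of_nonneg_right (h n) (norm_nonneg _))
    rw [norm_pow] at h2
    have h3 : 0 < ‖z‖ ^ n := by positivity
    rw [inv_pow, ← div_eq_mul_inv, ← mul_div_assoc, le_div_iff₀ h3, one_mul]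
    linarith
  have h2 := ((summable_succ_pow_mul_geometric κ (r := ‖z‖⁻¹) (by positivity)
    (inv_lt_one_of_one_lt₀ hz1)).tendsto_atTop_zero).const_mul (‖(1 : E →L[ℂ] E)‖ * C)
  rw [mul_zero] at h2
  have := ge_of_tendsto' h2 h1
  linarith

theorem spectrum_adjoint_subset [CompleteSpace E] {W : E →L[ℂ] E}
    (h : spectrum ℂ W ⊆ Metric.closedBall 0 1) :
    spectrum ℂ W.adjoint ⊆ Metric.closedBall 0 1 := by
  intro z hz
  rw [← ContinuousLinearMap.star_eq_adjoint, spectrum.map_star, Set.mem_star] at hz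
  simpa using h hz

theorem IsCoordShift.adjoint_kerVec [CompleteSpace E] (hs : IsTempered s) {W : E →L[ℂ] E}
    (hW : IsCoordShift b s W) {z : ℂ} (hz : ‖z‖ < 1) :
    W.adjoint (kerVec b s z) = conj z • kerVec b s z := by
  refine ext_inner_right ℂ fun x => ?_
  rw [ContinuousLinearMap.adjoint_inner_left, hW.inner_kerVec hs hz, inner_smul_left,
    Complex.conj_conj]

theorem kerVec_ne_zero (hs : IsTempered s) {w : ℂ} (hw : ‖w‖ < 1) : kerVec b s w ≠ 0 := by
  intro h
  have := repr_kerVec (b := b) hs hw 0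
  rw [h, map_zero] at this
  have h0 := (hs.pos 0).ne'
  simp only [lp.coeFn_zero, Pi.zero_apply, pow_zero, mul_one] at this
  exact h0 (Complex.ofReal_eq_zero.1 this.symm)

theorem IsCoordShift.repr_adjoint [CompleteSpace E] {W : E →L[ℂ] E}
    (hW : IsCoordShift b s W) (x : E) (n : ℕ) :
    b.repr (W.adjoint x) n = (s n / s (n + 1) : ℝ) * b.repr x (n + 1) :=
  IsShift.repr_adjoint hW x n

/-- An eigenvector of the backward shift is determined by its first coefficient. -/
theorem IsCoordShift.eq_zero_of_adjoint_apply_eq [CompleteSpace E] (hs : IsTempered s)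
    {W : E →L[ℂ] E} (hW : IsCoordShift b s W) {w : ℂ} {x : E} (hx : W.adjoint x = w • x)
    (h0 : b.repr x 0 = 0) : x = 0 := by
  refine b.ext_repr fun n => ?_
  rw [map_zero]
  induction n with
  | zero => simpa using h0
  | succ n ih =>
    have h1 := hW.repr_adjoint x n
    rw [hx, map_smul, lp.coeFn_smul, Pi.smul_apply, ih] at h1
    have h2 : ((s n / s (n + 1) : ℝ) : ℂ) ≠ 0 := by
      exact_mod_cast (div_pos (hs.pos _) (hs.pos _)).ne'
    have h3 : ((s n / s (n + 1) : ℝ) : ℂ) * b.repr x (n + 1) = 0 := by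
      rw [← h1]; simp
    simpa using (mul_eq_zero.1 h3).resolve_left h2

theorem IsCoordShift.eq_smul_kerVec [CompleteSpace E] (hs : IsTempered s)
    {W : E →L[ℂ] E} (hW : IsCoordShift b s W) {w : ℂ} (hw : ‖w‖ < 1) {x : E}
    (hx : W.adjoint x = conj w • x) : ∃ c : ℂ, x = c • kerVec b s w := by
  have h0 : (s 0 : ℂ) ≠ 0 := by exact_mod_cast (hs.pos 0).ne'
  refine ⟨b.repr x 0 / s 0, ?_⟩
  rw [← sub_eq_zero]
  refine hW.eq_zero_of_adjoint_apply_eq (w := conj w) hs ?_ ?_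
  · rw [map_sub, map_smul, hx, hW.adjoint_kerVec hs hw, smul_sub, smul_comm (conj w)]
  · rw [map_sub, map_smul, lp.coeFn_sub, lp.coeFn_smul, Pi.sub_apply, Pi.smul_apply,
      repr_kerVec hs hw]
    simp [h0]

theorem IsCoordShift.isCowenDouglas_adjoint [CompleteSpace E] (hs : IsTempered s)
    {W : E →L[ℂ] E} (hW : IsCoordShift b s W) :
    IsCowenDouglas 1 (Metric.ball 0 1) W.adjoint := by
  have hmem : ∀ (w : ℂ) (x : E),
      x ∈ (W.adjoint - w • ContinuousLinearMap.id ℂ E).ker ↔ W.adjoint x = w • x := by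
    intro w x
    rw [LinearMap.mem_ker]
    simp [sub_eq_zero]
  have hk : ∀ w : ℂ, ‖w‖ < 1 → W.adjoint (kerVec b s (conj w)) = w • kerVec b s (conj w) := by
    intro w hw
    simpa using hW.adjoint_kerVec hs (z := conj w) (by rwa [RCLike.norm_conj])
  refine ⟨fun w hw => ?_, fun w hw => ?_, ?_⟩
  · rw [mem_ball_zero_iff] at hw
    have hw' : ‖conj w‖ < 1 := by rwa [RCLike.norm_conj]
    refine (finrank_eq_one_iff_of_nonzero'
      (⟨kerVec b s (conj w), (hmem w _).2 (hk w hw)⟩ :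
        (W.adjoint - w • ContinuousLinearMap.id ℂ E).ker) ?_).2 ?_
    · intro h
      exact kerVec_ne_zero hs hw' (congrArg Subtype.val h)
    · rintro ⟨x, hx⟩
      obtain ⟨c, hc⟩ := hW.eq_smul_kerVec hs hw' (x := x) (by simpa using (hmem w x).1 hx)
      exact ⟨c, Subtype.ext hc.symm⟩
  · rw [mem_ball_zero_iff] at hw
    -- `R` has ratios `s (n + 1) / s n`, so it is a right inverse of `W.adjoint`. Then `(W.adjoint -
    -- w) R = 1 - w R` is invertible for `‖w‖ < 1`, and the range is the whole space.
    obtain ⟨R, hR⟩ := exists_isCoordShift b hs.inv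
    have hTR : W.adjoint * R = 1 := by
      ext x
      refine b.ext_repr fun n => ?_
      rw [mul_apply_eq_comp, hW.repr_adjoint, hR.repr_add]
      have h1 : (s n : ℂ) ≠ 0 := by exact_mod_cast (hs.pos n).ne'
      have h2 : (s (n + 1) : ℂ) ≠ 0 := by exact_mod_cast (hs.pos (n + 1)).ne'
      rw [one_apply_eq_self]
      push_cast
      field_simp
    obtain ⟨N, hN, -⟩ := isUnit_iff_exists.1
      (isUnit_one_sub_smul_of_spectrum_subset (hR.spectrum_subset hs.inv) hw)
    have h4 : (W.adjoint - w • ContinuousLinearMap.id ℂ E) * R = 1 - w • R := by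
      rw [sub_mul, hTR]
      rfl
    have h3 : (W.adjoint - w • ContinuousLinearMap.id ℂ E) * (R * N) = 1 := by
      rw [← mul_assoc, h4, hN]
    have : Set.range (W.adjoint - w • ContinuousLinearMap.id ℂ E) = Set.univ := by
      refine Set.range_eq_univ.2 fun x => ⟨R (N x), ?_⟩
      have := congrArg (fun S : E →L[ℂ] E => S x) h3
      simpa using this
    rw [this]
    exact isClosed_univ
  · rw [eq_top_iff, ← topologicalClosure_span_kerVec (b := b) hs]
    refine Submodule.topologicalClosure_mono (Submodule.span_le.2 ?_)
    rintro _ ⟨z, rfl⟩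
    have hz : (conj (z : ℂ)) ∈ Metric.ball (0 : ℂ) 1 := by
      rw [mem_ball_zero_iff, RCLike.norm_conj]; exact z.norm_lt_one
    refine Submodule.mem_iSup_of_mem (conj (z : ℂ)) (Submodule.mem_iSup_of_mem hz ?_)
    exact (hmem _ _).2 (hW.adjoint_kerVec hs z.norm_lt_one)

end KernelVectors

/-! ### Bounded multipliers. -/

section Multiplier

theorem hasSum_choose_mul_pow (μ : ℂ) {w : ℂ} (hw : ‖w‖ < 1) :
    HasSum (fun n => Ring.choose μ n * w ^ n) ((1 + w) ^ μ) := by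
  have h := (Complex.one_add_cpow_hasFPowerSeriesOnBall_zero (a := μ)).hasSum
    (mem_eball_zero_one_iff.2 hw)
  rw [zero_add] at h
  refine h.congr_fun fun n => ?_
  rw [binomialSeries_apply]
  simp [List.ofFn_const]

variable {E : Type*} [NormedAddCommGroup E] [InnerProductSpace ℂ E] [CompleteSpace E]
  {b : HilbertBasis ℕ ℂ E} {s : ℕ → ℝ}

/-- Powers of `1 - ā z` are multipliers. -/
theorem exists_multiplier_cpow (b : HilbertBasis ℕ ℂ E) (hs : IsTempered s) {a : ℂ} (ha : ‖a‖ < 1)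
    (μ : ℂ) : ∃ G : E →L[ℂ] E, ∀ z : ℂ, ‖z‖ < 1 → ∀ x,
      inner ℂ (kerVec b s z) (G x) = (1 - conj a * z) ^ μ * inner ℂ (kerVec b s z) x := by
  obtain ⟨W, hW⟩ := exists_isCoordShift b hs
  obtain ⟨C, κ, hC⟩ := hW.norm_pow_le hs
  -- The binomial coefficients are `O(r ^ (-n))` and `‖W ^ n‖` grows polynomially, so a radius
  -- strictly between `‖a‖` and `1` makes the binomial series in `W` converge absolutely.
  obtain ⟨r, har, hr1⟩ := exists_between ha
  have hr0 : 0 < r := (norm_nonneg a).trans_lt har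
  have hsum1 := (hasSum_choose_mul_pow μ (w := (r : ℂ))
    (by rwa [Complex.norm_real, Real.norm_of_nonneg hr0.le])).summable
  obtain ⟨M, hM⟩ := hsum1.tendsto_atTop_zero.norm.bddAbove_range
  have hM' : ∀ n, ‖Ring.choose μ n‖ * r ^ n ≤ M := by
    intro n
    have := hM ⟨n, rfl⟩
    simpa [abs_of_pos hr0] using this
  have hM0 : 0 ≤ M := le_trans (by positivity) (hM' 0)
  have hsum : Summable fun n => (Ring.choose μ n * (-conj a) ^ n) • W ^ n := by
    refine Summable.of_norm_bounded (g := fun n => M * C * (((n : ℝ) + 1) ^ κ * (‖a‖ / r) ^ n))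
      ((summable_succ_pow_mul_geometric κ (by positivity) ((div_lt_one hr0).2 har)).mul_left _)
      fun n => ?_
    rw [norm_smul, norm_mul, norm_pow, norm_neg, RCLike.norm_conj, div_pow]
    have h1 : ‖Ring.choose μ n‖ ≤ M / r ^ n := (le_div_iff₀ (by positivity)).2 (hM' n)
    calc ‖Ring.choose μ n‖ * ‖a‖ ^ n * ‖W ^ n‖
        ≤ M / r ^ n * ‖a‖ ^ n * (C * ((n : ℝ) + 1) ^ κ) := by
          gcongr
          exact hC n
      _ = _ := by ring
  refine ⟨∑' n, (Ring.choose μ n * (-conj a) ^ n) • W ^ n, fun z hz x => ?_⟩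
  have h1 := (hsum.hasSum.mapL (ContinuousLinearMap.apply ℂ E x)).mapL
    (innerSL ℂ (kerVec b s z))
  have hpow : ∀ n : ℕ, inner ℂ (kerVec b s z) ((W ^ n) x) =
      z ^ n * inner ℂ (kerVec b s z) x := by
    intro n
    induction n with
    | zero => simp
    | succ n ih =>
      rw [pow_succ', mul_apply_eq_comp, hW.inner_kerVec hs hz, ih, pow_succ']
      ring
  have hw : ‖-(conj a * z)‖ < 1 := by
    rw [norm_neg, norm_mul, RCLike.norm_conj]
    nlinarith [norm_nonneg a, norm_nonneg z]
  have h2 := (hasSum_choose_mul_pow μ hw).mul_right (inner ℂ (kerVec b s z) x)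
  rw [← sub_eq_add_neg] at h2
  refine HasSum.unique ?_ h2
  refine h1.congr_fun fun n => ?_
  simp only [ContinuousLinearMap.apply_apply, map_smul,
    innerSL_apply_apply, hpow, smul_eq_mul]
  rw [← neg_mul, mul_pow]
  ring

end Multiplier

/-! ### The weight of `K_(γ)`. -/

section PowerWeight

/-- The weight of the space with kernel `∑ (n + 1) ^ γ (z w̄) ^ n`. -/
noncomputable def powerWeight (γ : ℝ) (n : ℕ) : ℝ := ((n : ℝ) + 1) ^ (γ / 2)

theorem powerWeight_sq (γ : ℝ) (n : ℕ) : powerWeight γ n ^ 2 = ((n : ℝ) + 1) ^ γ := by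
  rw [powerWeight, ← Real.rpow_natCast, ← Real.rpow_mul (by positivity)]
  norm_num

theorem powerWeight_neg (γ : ℝ) (n : ℕ) : powerWeight (-γ) n = (powerWeight γ n)⁻¹ := by
  rw [powerWeight, powerWeight, neg_div, Real.rpow_neg (by positivity)]

theorem powerWeight_add_two (γ : ℝ) (n : ℕ) :
    powerWeight (γ + 2) n = ((n : ℝ) + 1) * powerWeight γ n := by
  rw [powerWeight, powerWeight, add_div, div_self two_ne_zero, Real.rpow_add_one (by positivity),
    mul_comm]

/-- One bound is monotonicity, the other follows from `m + k + 1 ≤ (k + 1) (m + 1)`. -/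
theorem isTempered_powerWeight_of_nonneg {γ : ℝ} (hγ : 0 ≤ γ) : IsTempered (powerWeight γ) := by
  refine ⟨fun n => by unfold powerWeight; positivity, 1, ⌈γ / 2⌉₊, fun m k => ⟨?_, ?_⟩⟩
  · have h1 : powerWeight γ m ≤ powerWeight γ (m + k) := by
      unfold powerWeight
      push_cast
      gcongr
      linarith [(Nat.cast_nonneg k : (0 : ℝ) ≤ k)]
    have h2 : (1 : ℝ) ≤ ((k : ℝ) + 1) ^ ⌈γ / 2⌉₊ :=
      one_le_pow₀ (by linarith [(Nat.cast_nonneg k : (0 : ℝ) ≤ k)])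
    have h3 : 0 ≤ powerWeight γ (m + k) := by unfold powerWeight; positivity
    nlinarith
  · have h1 : ((m + k : ℕ) : ℝ) + 1 ≤ ((k : ℝ) + 1) * ((m : ℝ) + 1) := by
      push_cast
      nlinarith [(Nat.cast_nonneg k : (0 : ℝ) ≤ k), (Nat.cast_nonneg m : (0 : ℝ) ≤ m)]
    have h2 : ((k : ℝ) + 1) ^ (γ / 2) ≤ ((k : ℝ) + 1) ^ ⌈γ / 2⌉₊ := by
      rw [← Real.rpow_natCast]
      exact Real.rpow_le_rpow_of_exponent_le (by linarith [(Nat.cast_nonneg k : (0 : ℝ) ≤ k)])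
        (Nat.le_ceil _)
    unfold powerWeight
    calc (((m + k : ℕ) : ℝ) + 1) ^ (γ / 2) ≤ (((k : ℝ) + 1) * ((m : ℝ) + 1)) ^ (γ / 2) := by
          gcongr
      _ = ((k : ℝ) + 1) ^ (γ / 2) * ((m : ℝ) + 1) ^ (γ / 2) :=
          Real.mul_rpow (by positivity) (by positivity)
      _ ≤ _ := by
          rw [one_mul]
          gcongr

theorem isTempered_powerWeight (γ : ℝ) : IsTempered (powerWeight γ) := by
  rcases le_total 0 γ with h | h
  · exact isTempered_powerWeight_of_nonneg h
  · have := (isTempered_powerWeight_of_nonneg (neg_nonneg.2 h)).inv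
    simpa only [← powerWeight_neg, neg_neg] using this

end PowerWeight

/-! ### The weight of `(1 - z w̄) ^ (-λ)` and its comparison with the power weight. -/

section BinomialWeight

theorem multichoose_succ_mul (lam : ℂ) (n : ℕ) :
    ((n : ℂ) + 1) * Ring.multichoose lam (n + 1) = (lam + n) * Ring.multichoose lam n := by
  have h1 := Ring.factorial_nsmul_multichoose_eq_ascPochhammer lam n
  have h2 := Ring.factorial_nsmul_multichoose_eq_ascPochhammer lam (n + 1)
  rw [ascPochhammer_succ_right, Polynomial.smeval_mul, ← h1, nsmul_eq_mul, nsmul_eq_mul,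
    Nat.factorial_succ, Polynomial.smeval_add, Polynomial.smeval_X, Polynomial.smeval_natCast] at h2
  have h3 : (n.factorial : ℂ) ≠ 0 := by exact_mod_cast n.factorial_ne_zero
  refine mul_left_cancel₀ h3 ?_
  push_cast at h2
  simp only [pow_one, pow_zero, nsmul_eq_mul, mul_one] at h2
  linear_combination h2

/-- The coefficients of `(1 - x) ^ (-λ)`. -/
noncomputable def binomialCoeff (lam : ℝ) (n : ℕ) : ℝ :=
  ∏ j ∈ Finset.range n, (lam + j) / ((j : ℝ) + 1)

theorem binomialCoeff_pos {lam : ℝ} (h : 0 < lam) (n : ℕ) : 0 < binomialCoeff lam n :=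
  Finset.prod_pos fun j _ => by positivity

theorem ofReal_binomialCoeff (lam : ℝ) (n : ℕ) :
    (binomialCoeff lam n : ℂ) = Ring.multichoose (lam : ℂ) n := by
  induction n with
  | zero => simp [binomialCoeff]
  | succ n ih =>
    have h := multichoose_succ_mul (lam : ℂ) n
    have h0 : (n : ℂ) + 1 ≠ 0 := by exact_mod_cast n.succ_ne_zero
    refine mul_left_cancel₀ h0 ?_
    rw [h, ← ih, binomialCoeff, binomialCoeff, Finset.prod_range_succ]
    push_cast
    field_simp

theorem hasSum_binomialCoeff (lam : ℝ) {x : ℂ} (hx : ‖x‖ < 1) :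
    HasSum (fun n => (binomialCoeff lam n : ℂ) * x ^ n) ((1 - x) ^ (-lam : ℂ)) := by
  have h := (Complex.one_div_one_sub_cpow_hasFPowerSeriesOnBall_zero (lam : ℂ)).hasSum
    (mem_eball_zero_one_iff.2 hx)
  rw [zero_add, one_div, ← Complex.cpow_neg] at h
  refine h.congr_fun fun n => ?_
  have h1 : Ring.choose ((lam : ℂ) + n - 1) n = Ring.multichoose (lam : ℂ) n := by
    rw [Ring.multichoose_eq]
  rw [ofReal_binomialCoeff, ← h1]
  simp [FormalMultilinearSeries.ofScalars, List.ofFn_const]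

/-- Euler's sequence for `Γ` has in its denominator the rising factorial of the coefficient, with
the one further factor `lam + n`. -/
theorem binomialCoeff_mul_GammaSeq {lam : ℝ} (h : 0 < lam) (n : ℕ) :
    binomialCoeff lam n * (Real.GammaSeq lam n * (lam + n)) = (n : ℝ) ^ lam := by
  have h1 : binomialCoeff lam n * n.factorial = ∏ j ∈ Finset.range n, (lam + j) := by
    rw [binomialCoeff, Finset.prod_div_distrib, ← Finset.prod_range_add_one_eq_factorial]
    push_cast
    rw [div_mul_cancel₀]
    exact Finset.prod_ne_zero_iff.2 fun j _ => by positivity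
  have h2 : ∏ j ∈ Finset.range (n + 1), (lam + j) ≠ 0 :=
    Finset.prod_ne_zero_iff.2 fun j _ => by positivity
  rw [Real.GammaSeq]
  rw [Finset.prod_range_succ] at h2 ⊢
  rw [← h1] at h2 ⊢
  have h3 : lam + n ≠ 0 := by positivity
  have h4 := (binomialCoeff_pos h n).ne'
  have h5 : (n.factorial : ℝ) ≠ 0 := by exact_mod_cast n.factorial_ne_zero
  field_simp

theorem tendsto_binomialCoeff_div {lam : ℝ} (h : 0 < lam) :
    Filter.Tendsto (fun n : ℕ => binomialCoeff lam n / ((n : ℝ) + 1) ^ (lam - 1)) Filter.atTop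
      (nhds (Real.Gamma lam)⁻¹) := by
  have hG := Real.GammaSeq_tendsto_Gamma lam
  have hΓ := (Real.Gamma_pos_of_pos h).ne'
  have h1 : Filter.Tendsto (fun n : ℕ => (n : ℝ) / ((n : ℝ) + 1)) Filter.atTop (nhds 1) :=
    tendsto_natCast_div_add_atTop 1
  have h2 : Filter.Tendsto (fun n : ℕ => (n : ℝ) / ((n : ℝ) + lam)) Filter.atTop (nhds 1) :=
    tendsto_natCast_div_add_atTop lam
  have h3 := ((h1.rpow_const (p := lam - 1) (Or.inl one_ne_zero)).mul h2).mul (hG.inv₀ hΓ)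
  simp only [Real.one_rpow, one_mul] at h3
  refine h3.congr' ?_
  have hne := hG.eventually_ne hΓ
  filter_upwards [Filter.eventually_gt_atTop 0, hne] with n hn hne
  have hn' : (0 : ℝ) < n := by exact_mod_cast hn
  have h4 := binomialCoeff_mul_GammaSeq h n
  have h5 : (0 : ℝ) < ((n : ℝ) + 1) ^ (lam - 1) := by positivity
  have h6 : (n : ℝ) ^ lam = (n : ℝ) ^ (lam - 1) * n := by
    rw [← Real.rpow_add_one hn'.ne']; ring_nf
  have h7 : lam + n ≠ 0 := by positivity
  have h8 : (n : ℝ) + lam ≠ 0 := by positivity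
  rw [Real.div_rpow hn'.le (by positivity)]
  field_simp
  rw [h6] at h4
  linear_combination -h4

/-- The ratio converges to `1 / Γ(lam)`, which is positive, so the ratio and its inverse are both
bounded. -/
theorem exists_bounds_binomialCoeff {lam : ℝ} (h : 0 < lam) :
    ∃ C : ℝ, 0 < C ∧ ∀ n : ℕ, binomialCoeff lam n ≤ C * ((n : ℝ) + 1) ^ (lam - 1) ∧
      ((n : ℝ) + 1) ^ (lam - 1) ≤ C * binomialCoeff lam n := by
  have h1 := tendsto_binomialCoeff_div h
  have hΓ := (Real.Gamma_pos_of_pos h)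
  obtain ⟨C1, hC1⟩ := h1.bddAbove_range
  obtain ⟨C2, hC2⟩ := (h1.inv₀ (inv_pos.2 hΓ).ne').bddAbove_range
  refine ⟨max 1 (max C1 C2), lt_of_lt_of_le one_pos (le_max_left _ _), fun n => ?_⟩
  have hq := binomialCoeff_pos h n
  have hp : 0 < ((n : ℝ) + 1) ^ (lam - 1) := by positivity
  have hc1 := hC1 ⟨n, rfl⟩
  have hc2 := hC2 ⟨n, rfl⟩
  simp only [inv_div] at hc1 hc2
  rw [← div_le_iff₀ hp, ← div_le_iff₀ hq]
  exact ⟨hc1.trans ((le_max_left _ _).trans (le_max_right _ _)),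
    hc2.trans ((le_max_right _ _).trans (le_max_right _ _))⟩

/-- The weight of the space with kernel `(1 - z w̄) ^ (-λ)`. -/
noncomputable def binomialWeight (lam : ℝ) (n : ℕ) : ℝ := √(binomialCoeff lam n)

theorem binomialWeight_sq {lam : ℝ} (h : 0 < lam) (n : ℕ) :
    binomialWeight lam n ^ 2 = binomialCoeff lam n :=
  Real.sq_sqrt (binomialCoeff_pos h n).le

theorem exists_bounds_binomialWeight {lam : ℝ} (h : 0 < lam) :
    ∃ C : ℝ, 0 < C ∧ ∀ n : ℕ, binomialWeight lam n ≤ C * powerWeight (lam - 1) n ∧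
      powerWeight (lam - 1) n ≤ C * binomialWeight lam n := by
  obtain ⟨C, hC, hb⟩ := exists_bounds_binomialCoeff h
  refine ⟨√C, Real.sqrt_pos.2 hC, fun n => ?_⟩
  have hp : powerWeight (lam - 1) n = √(((n : ℝ) + 1) ^ (lam - 1)) := by
    rw [← powerWeight_sq, Real.sqrt_sq ((isTempered_powerWeight _).pos n).le]
  rw [hp, binomialWeight, ← Real.sqrt_mul hC.le, ← Real.sqrt_mul hC.le]
  exact ⟨Real.sqrt_le_sqrt (hb n).1, Real.sqrt_le_sqrt (hb n).2⟩

theorem IsTempered.of_bounds {s t : ℕ → ℝ} (hs : IsTempered s) (ht : ∀ n, 0 < t n) {C : ℝ}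
    (hC : 0 < C) (h : ∀ n, t n ≤ C * s n ∧ s n ≤ C * t n) : IsTempered t := by
  obtain ⟨D, κ, hD⟩ := hs.bound
  have hD0 : 0 ≤ D := by
    have := (hD 0 0).1
    have h0 := hs.pos 0
    simp only [Nat.cast_zero, zero_add, one_pow, mul_one] at this
    nlinarith
  refine ⟨ht, C * D * C, κ, fun m k => ⟨?_, ?_⟩⟩
  · calc t m ≤ C * s m := (h m).1
      _ ≤ C * (D * ((k : ℝ) + 1) ^ κ * (C * t (m + k))) := by
        gcongr
        refine (hD m k).1.trans ?_
        gcongr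
        exact (h _).2
      _ = _ := by ring
  · calc t (m + k) ≤ C * s (m + k) := (h _).1
      _ ≤ C * (D * ((k : ℝ) + 1) ^ κ * (C * t m)) := by
        gcongr
        refine (hD m k).2.trans ?_
        gcongr
        exact (h _).2
      _ = _ := by ring

theorem isTempered_binomialWeight {lam : ℝ} (h : 0 < lam) : IsTempered (binomialWeight lam) := by
  obtain ⟨C, hC, hb⟩ := exists_bounds_binomialWeight h
  exact (isTempered_powerWeight (lam - 1)).of_bounds
    (fun n => Real.sqrt_pos.2 (binomialCoeff_pos h n)) hC hb

end BinomialWeight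

/-! ### Disc automorphisms. -/

section Moebius

theorem norm_conj_mul_lt_one {a z : ℂ} (ha : ‖a‖ < 1) (hz : ‖z‖ < 1) : ‖conj a * z‖ < 1 := by
  rw [norm_mul, RCLike.norm_conj]
  nlinarith [norm_nonneg a, norm_nonneg z]

theorem norm_mul_conj_lt_one {a z : ℂ} (ha : ‖a‖ < 1) (hz : ‖z‖ < 1) : ‖a * conj z‖ < 1 := by
  rw [mul_comm]
  exact norm_conj_mul_lt_one hz ha

theorem one_sub_conj_mul_ne_zero {a z : ℂ} (ha : ‖a‖ < 1) (hz : ‖z‖ < 1) : 1 - conj a * z ≠ 0 :=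
  one_sub_ne_zero_of_norm_lt_one (norm_conj_mul_lt_one ha hz)

theorem re_one_sub_pos {z : ℂ} (hz : ‖z‖ < 1) : 0 < (1 - z).re := by
  have := (Complex.re_le_norm z).trans_lt hz
  simpa using this

theorem exp_mul_I_mul_conj (θ : ℝ) :
    Complex.exp (θ * Complex.I) * conj (Complex.exp (θ * Complex.I)) = 1 := by
  rw [← Complex.exp_conj, ← Complex.exp_add]
  simp

/-- With `w = z` this gives invariance of the disc; in general it is the covariance behind the
unitaries for `(1 - z w̄) ^ (-λ)`. -/
theorem one_sub_moebius_mul_conj (θ : ℝ) {a z w : ℂ} (ha : ‖a‖ < 1) (hz : ‖z‖ < 1) (hw : ‖w‖ < 1) :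
    (1 - moebius θ a z * conj (moebius θ a w)) * ((1 - conj a * z) * (1 - a * conj w)) =
      (1 - conj a * a) * (1 - z * conj w) := by
  have h1 := one_sub_conj_mul_ne_zero ha hz
  have h2 : 1 - a * conj w ≠ 0 := one_sub_ne_zero_of_norm_lt_one (norm_mul_conj_lt_one ha hw)
  have h3 := exp_mul_I_mul_conj θ
  have h4 : moebius θ a z * (1 - conj a * z) = Complex.exp (θ * Complex.I) * (z - a) := by
    rw [moebius, mul_assoc, div_mul_cancel₀ _ h1]
  have h5 : conj (moebius θ a w) * (1 - a * conj w) =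
      conj (Complex.exp (θ * Complex.I)) * (conj w - conj a) := by
    rw [moebius]
    simp only [map_mul, map_div₀, map_sub, map_one, Complex.conj_conj]
    rw [mul_assoc, div_mul_cancel₀ _ h2]
  calc _ = (1 - conj a * z) * (1 - a * conj w) - (moebius θ a z * (1 - conj a * z)) *
        (conj (moebius θ a w) * (1 - a * conj w)) := by ring
    _ = (1 - conj a * z) * (1 - a * conj w) - (Complex.exp (θ * Complex.I) *
        conj (Complex.exp (θ * Complex.I))) * ((z - a) * (conj w - conj a)) := by
        rw [h4, h5]; ring
    _ = _ := by rw [h3]; ring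

theorem norm_moebius_lt_one (θ : ℝ) {a z : ℂ} (ha : ‖a‖ < 1) (hz : ‖z‖ < 1) :
    ‖moebius θ a z‖ < 1 := by
  have h := one_sub_moebius_mul_conj θ ha hz hz
  have h1 : (1 - conj a * z) * (1 - a * conj z) = ((‖1 - conj a * z‖ ^ 2 : ℝ) : ℂ) := by
    rw [Complex.ofReal_pow, ← Complex.mul_conj']
    simp
  rw [h1, Complex.mul_conj', Complex.mul_conj', Complex.conj_mul'] at h
  have h2 : (1 - ‖moebius θ a z‖ ^ 2) * ‖1 - conj a * z‖ ^ 2 = (1 - ‖a‖ ^ 2) * (1 - ‖z‖ ^ 2) := by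
    exact_mod_cast h
  have h3 : 0 < (1 - ‖a‖ ^ 2) * (1 - ‖z‖ ^ 2) := by
    apply mul_pos <;> nlinarith [norm_nonneg a, norm_nonneg z]
  rw [← h2] at h3
  have h4 := pos_of_mul_pos_left h3 (by positivity)
  nlinarith [norm_nonneg (moebius θ a z)]

theorem norm_neg_exp_mul_lt_one (θ : ℝ) {a : ℂ} (ha : ‖a‖ < 1) :
    ‖-(Complex.exp (θ * Complex.I) * a)‖ < 1 := by
  rwa [norm_neg, norm_mul, Complex.norm_exp_ofReal_mul_I, one_mul]

theorem moebius_moebius (θ : ℝ) {a z : ℂ} (ha : ‖a‖ < 1) (hz : ‖z‖ < 1) :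
    moebius (-θ) (-(Complex.exp (θ * Complex.I) * a)) (moebius θ a z) = z := by
  have h1 := one_sub_conj_mul_ne_zero ha hz
  have h2 := one_sub_conj_mul_ne_zero ha ha
  have h3 := exp_mul_I_mul_conj θ
  have h4 : Complex.exp ((-θ : ℝ) * Complex.I) * Complex.exp (θ * Complex.I) = 1 := by
    rw [← Complex.exp_add]; simp
  rw [moebius, moebius]
  set e := Complex.exp (θ * Complex.I)
  set e' := Complex.exp ((-θ : ℝ) * Complex.I)
  have h5 : 1 - conj (-(e * a)) * (e * ((z - a) / (1 - conj a * z))) =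
      (1 - conj a * a) / (1 - conj a * z) := by
    rw [map_neg, map_mul]
    calc _ = 1 + (e * conj e) * conj a * ((z - a) / (1 - conj a * z)) := by ring
      _ = _ := by
        rw [h3]
        field_simp
        ring
  rw [h5]
  calc e' * ((e * ((z - a) / (1 - conj a * z)) - -(e * a)) / ((1 - conj a * a) / (1 - conj a * z)))
      = (e' * e) * (((z - a) / (1 - conj a * z) + a) / ((1 - conj a * a) / (1 - conj a * z))) := by
        ring
    _ = z := by
        rw [h4, one_mul, div_add' _ _ _ h1, div_div_div_cancel_right₀ h1, div_eq_iff h2]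
        ring

theorem moebius_moebius' (θ : ℝ) {a z : ℂ} (ha : ‖a‖ < 1) (hz : ‖z‖ < 1) :
    moebius θ a (moebius (-θ) (-(Complex.exp (θ * Complex.I) * a)) z) = z := by
  have h := moebius_moebius (-θ) (norm_neg_exp_mul_lt_one θ ha) hz
  have h4 : Complex.exp ((-θ : ℝ) * Complex.I) * Complex.exp (θ * Complex.I) = 1 := by
    rw [← Complex.exp_add]; simp
  have h5 : -(Complex.exp ((-θ : ℝ) * Complex.I) * -(Complex.exp (θ * Complex.I) * a)) = a := by
    linear_combination a * h4
  rwa [h5, neg_neg] at h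

theorem hasDerivAt_moebius (θ : ℝ) {a z : ℂ} (ha : ‖a‖ < 1) (hz : ‖z‖ < 1) :
    HasDerivAt (moebius θ a)
      (Complex.exp (θ * Complex.I) * (1 - conj a * a) * (1 - conj a * z) ^ (-2 : ℂ)) z := by
  have h1 := one_sub_conj_mul_ne_zero ha hz
  have h2 : HasDerivAt (fun z : ℂ => z - a) 1 z := (hasDerivAt_id z).sub_const a
  have h3 : HasDerivAt (fun z : ℂ => 1 - conj a * z) (-(conj a * 1)) z :=
    ((hasDerivAt_id z).const_mul (conj a)).const_sub 1
  convert! (h2.div h3 h1).const_mul (Complex.exp (θ * Complex.I)) using 1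
  rw [Complex.cpow_neg, Complex.cpow_ofNat]
  field_simp
  ring

end Moebius

/-! ### The unitary action on the space with kernel `(1 - z w̄) ^ (-λ)`. -/

section BinomialKernel

/-- The cocycle identity for `(1 - z w̄) ^ (-λ)`, in logarithmic form. -/
theorem log_add_log_add_log {X Y u v : ℂ} {d : ℝ} (hX : 0 < X.re) (hY : 0 < Y.re) (hu : 0 < u.re)
    (hv : 0 < v.re) (hd : 0 < d) (h : X * (u * v) = d * Y) :
    Complex.log X + (Complex.log u + Complex.log v) = Real.log d + Complex.log Y := by
  have hne : ∀ {x : ℂ}, 0 < x.re → x ≠ 0 := by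
    intro x hx h0
    simp [h0] at hx
  have hd' : (d : ℂ) ≠ 0 := by exact_mod_cast hd.ne'
  have hexp : Complex.exp (Complex.log X + (Complex.log u + Complex.log v)) =
      Complex.exp (Real.log d + Complex.log Y) := by
    rw [Complex.exp_add, Complex.exp_add, Complex.exp_add, Complex.exp_log (hne hX),
      Complex.exp_log (hne hu), Complex.exp_log (hne hv), Complex.exp_log (hne hY),
      Complex.ofReal_log hd.le, Complex.exp_log hd', h]
  obtain ⟨n, hn⟩ := Complex.exp_eq_exp_iff_exists_int.1 hexp
  have him := congrArg Complex.im hn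
  simp only [Complex.add_im, Complex.log_im, Complex.ofReal_im, zero_add] at him
  have h1 : ((n : ℂ) * (2 * Real.pi * Complex.I)).im = n * (2 * Real.pi) := by
    simp
  rw [h1] at him
  have harg : ∀ {x : ℂ}, 0 < x.re → |x.arg| < Real.pi / 2 := fun hx =>
    Complex.abs_arg_lt_pi_div_two_iff.2 (Or.inl hx)
  have a1 := abs_lt.1 (harg hX)
  have a2 := abs_lt.1 (harg hY)
  have a3 := abs_lt.1 (harg hu)
  have a4 := abs_lt.1 (harg hv)
  have hpi := Real.pi_pos
  -- The four arguments lie in `(-π/2, π/2)`, so the two imaginary parts differ by less than `2π`.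
  have hn0 : n = 0 := by
    have h2 : (n : ℝ) < 1 := by
      by_contra! hge
      nlinarith
    have h3 : (-1 : ℝ) < n := by
      by_contra! hge
      nlinarith
    have h2' : n < 1 := by exact_mod_cast h2
    have h3' : -1 < n := by exact_mod_cast h3
    omega
  rw [hn, hn0]
  simp

theorem conj_log_of_re_pos {x : ℂ} (hx : 0 < x.re) :
    conj (Complex.log x) = Complex.log (conj x) := by
  refine (Complex.log_conj x ?_).symm
  have := abs_lt.1 (Complex.abs_arg_lt_pi_div_two_iff.2 (Or.inl hx) : |x.arg| < Real.pi / 2)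
  have hpi := Real.pi_pos
  linarith

variable {E : Type*} [NormedAddCommGroup E] [InnerProductSpace ℂ E]

theorem inner_kerVec_binomialWeight (b : HilbertBasis ℕ ℂ E) {lam : ℝ} (hl : 0 < lam) {z w : ℂ}
    (hz : ‖z‖ < 1) (hw : ‖w‖ < 1) :
    inner ℂ (kerVec b (binomialWeight lam) z) (kerVec b (binomialWeight lam) w) =
      Complex.exp (-lam * Complex.log (1 - z * conj w)) := by
  have h1 := hasSum_inner_kerVec_kerVec (b := b) (isTempered_binomialWeight hl) hz hw
  simp only [binomialWeight_sq hl] at h1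
  have hzw := norm_mul_conj_lt_one hz hw
  rw [h1.unique (hasSum_binomialCoeff lam hzw),
    Complex.cpow_def_of_ne_zero (one_sub_ne_zero_of_norm_lt_one hzw), mul_comm]

/-- The multiplier `(φ') ^ (λ / 2)`, up to a unimodular constant. -/
noncomputable def moebiusMultiplier (lam : ℝ) (a z : ℂ) : ℂ :=
  Complex.exp (-lam * (Complex.log (1 - conj a * z) - Real.log (1 - ‖a‖ ^ 2) / 2))

/-- The automorphism is onto the disc and the scalars do not vanish, so these vectors span the same
lines as the kernel vectors. -/
theorem span_range_smul_kerVec [CompleteSpace E] (b : HilbertBasis ℕ ℂ E) {s : ℕ → ℝ} (hs : IsTempered s) (θ : ℝ)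
    {a : ℂ} (ha : ‖a‖ < 1) {c : ℂ → ℂ} (hc : ∀ z, c z ≠ 0) :
    (Submodule.span ℂ (Set.range fun z : Complex.UnitDisc =>
      c z • kerVec b s (moebius θ a z))).topologicalClosure = ⊤ := by
  rw [eq_top_iff, ← topologicalClosure_span_kerVec (b := b) hs]
  refine Submodule.topologicalClosure_mono (Submodule.span_le.2 ?_)
  rintro _ ⟨z, rfl⟩
  have hz := norm_moebius_lt_one (-θ) (norm_neg_exp_mul_lt_one θ ha) z.norm_lt_one
  have h1 := moebius_moebius' θ ha z.norm_lt_one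
  have h2 := Submodule.smul_mem _ (c (moebius (-θ) (-(Complex.exp (θ * Complex.I) * a)) z))⁻¹
    (Submodule.subset_span (R := ℂ) (s := Set.range fun z : Complex.UnitDisc =>
      c z • kerVec b s (moebius θ a z)) ⟨Complex.UnitDisc.mk _ hz, rfl⟩)
  simp only [Complex.UnitDisc.coe_mk] at h2
  rw [h1, smul_smul, inv_mul_cancel₀ (hc _), one_smul] at h2
  exact h2

/-- The unitary `f ↦ j · (f ∘ φ)`, described through its adjoint on the kernel vectors. -/
theorem exists_unitary_binomialWeight [CompleteSpace E] (b : HilbertBasis ℕ ℂ E) {lam : ℝ} (hl : 0 < lam) (θ : ℝ)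
    {a : ℂ} (ha : ‖a‖ < 1) : ∃ U : E ≃ₗᵢ[ℂ] E, ∀ z : ℂ, ‖z‖ < 1 →
      U (kerVec b (binomialWeight lam) z) =
        conj (moebiusMultiplier lam a z) • kerVec b (binomialWeight lam) (moebius θ a z) := by
  have hs := isTempered_binomialWeight hl
  obtain ⟨U, hU⟩ := exists_linearIsometryEquiv_of_inner_eq
    (topologicalClosure_span_kerVec (b := b) hs)
    (span_range_smul_kerVec b hs θ ha (c := fun z => conj (moebiusMultiplier lam a z))
      fun z => by simp [moebiusMultiplier, Complex.exp_ne_zero])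
    (fun z w => by
      have hz := z.norm_lt_one
      have hw := w.norm_lt_one
      have hz' := norm_moebius_lt_one θ ha hz
      have hw' := norm_moebius_lt_one θ ha hw
      have hd : 0 < 1 - ‖a‖ ^ 2 := by nlinarith [norm_nonneg a]
      rw [inner_smul_left, inner_smul_right, Complex.conj_conj,
        inner_kerVec_binomialWeight b hl hz hw, inner_kerVec_binomialWeight b hl hz' hw']
      -- Equality of the Gram matrices is compared in the exponents, where multiplying by a
      -- non-integral `lam` raises no question of branches.
      have hlog := log_add_log_add_log (re_one_sub_pos (norm_mul_conj_lt_one hz' hw'))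
        (re_one_sub_pos (norm_mul_conj_lt_one hz hw)) (re_one_sub_pos (norm_conj_mul_lt_one ha hz))
        (re_one_sub_pos (norm_mul_conj_lt_one ha hw)) hd (by
          rw [one_sub_moebius_mul_conj θ ha hz hw, Complex.conj_mul']
          push_cast
          ring)
      have hconj : conj (moebiusMultiplier lam a w) = Complex.exp (-lam *
          (Complex.log (1 - a * conj (w : ℂ)) - Real.log (1 - ‖a‖ ^ 2) / 2)) := by
        rw [moebiusMultiplier, ← Complex.exp_conj]
        simp only [map_mul, map_neg, map_sub, map_div₀, Complex.conj_ofReal, map_ofNat,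
          conj_log_of_re_pos (re_one_sub_pos (norm_conj_mul_lt_one ha hw)), map_one,
          Complex.conj_conj]
      rw [hconj, moebiusMultiplier, ← Complex.exp_add, ← Complex.exp_add]
      congr 1
      linear_combination lam * hlog)
  exact ⟨U, fun z hz => hU (Complex.UnitDisc.mk z hz)⟩

end BinomialKernel

/-! ### Intertwining relations and change of weight. -/

section Intertwining

variable {E : Type*} [NormedAddCommGroup E] [InnerProductSpace ℂ E]
  {b : HilbertBasis ℕ ℂ E} {s : ℕ → ℝ}

/-- The eigenvalue at `kerVec b s z` is `conj z`, and `φ_{θ,a}(conj z)` is the conjugate of `φ_{-θ,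
conj a}(z)`; hence the conjugated parameters. The free scalar `c` covers both the unitaries and
plain composition. -/
theorem IsCoordShift.intertwining [CompleteSpace E] (hs : IsTempered s) {W : E →L[ℂ] E} (hW : IsCoordShift b s W)
    {θ : ℝ} {a : ℂ} (ha : ‖a‖ < 1) {L : E →L[ℂ] E} {c : ℂ → ℂ}
    (hL : ∀ z, ‖z‖ < 1 → L (kerVec b s z) = c z • kerVec b s (moebius (-θ) (conj a) z)) :
    W.adjoint * L * (1 - conj a • W.adjoint) =
      Complex.exp (θ * Complex.I) • (L * (W.adjoint - a • 1)) := by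
  refine ContinuousLinearMap.ext_on (s := Set.range fun z : Complex.UnitDisc => kerVec b s z)
    (Submodule.dense_iff_topologicalClosure_eq_top.2 (topologicalClosure_span_kerVec hs)) ?_
  rintro _ ⟨z, rfl⟩
  have hz := z.norm_lt_one
  have ha' : ‖conj a‖ < 1 := by rwa [RCLike.norm_conj]
  have hφ := norm_moebius_lt_one (-θ) ha' hz
  have h1 : (1 - conj a • W.adjoint) (kerVec b s z) = (1 - conj a * conj (z : ℂ)) • kerVec b s z := by
    simp only [FunLike.coe_sub, Pi.sub_apply, one_apply_eq_self, FunLike.coe_smul, Pi.smul_apply,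
      hW.adjoint_kerVec hs hz]
    module
  have h2 : (W.adjoint - a • 1) (kerVec b s z) = (conj (z : ℂ) - a) • kerVec b s z := by
    simp only [FunLike.coe_sub, Pi.sub_apply, one_apply_eq_self, FunLike.coe_smul, Pi.smul_apply,
      hW.adjoint_kerVec hs hz]
    module
  simp only [mul_apply_eq_comp, FunLike.coe_smul, Pi.smul_apply]
  rw [h1, h2, map_smul, map_smul, map_smul, hL z hz, map_smul, hW.adjoint_kerVec hs hφ]
  simp only [smul_smul]
  congr 1
  have h3 := one_sub_conj_mul_ne_zero ha hz
  have h4 : conj (moebius (-θ) (conj a) z) * (1 - conj a * conj (z : ℂ)) =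
      Complex.exp (θ * Complex.I) * (conj (z : ℂ) - a) := by
    have h5 : 1 - a * (z : ℂ) ≠ 0 := by
      have := one_sub_conj_mul_ne_zero ha' hz
      rwa [Complex.conj_conj] at this
    have h6 : 1 - conj a * conj (z : ℂ) ≠ 0 := by
      intro h
      apply h5
      have := congrArg conj h
      simpa using this
    rw [moebius, map_mul, ← Complex.exp_conj]
    simp only [map_mul, map_div₀, map_sub, map_one, map_neg, Complex.conj_conj,
      Complex.conj_ofReal, Complex.conj_I, Complex.ofReal_neg, neg_mul_neg]
    rw [mul_assoc, div_mul_cancel₀ _ h6]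
  linear_combination c z * h4

theorem IsCoordShift.isHomogeneousOperator_adjoint [CompleteSpace E] {lam : ℝ} (hl : 0 < lam) {W : E →L[ℂ] E}
    (hW : IsCoordShift b (binomialWeight lam) W) : IsHomogeneousOperator W.adjoint := by
  have hs := isTempered_binomialWeight hl
  have hσ := spectrum_adjoint_subset (hW.spectrum_subset hs)
  refine ⟨hσ, fun θ a ha => ?_⟩
  obtain ⟨U, hU⟩ := exists_unitary_binomialWeight b hl (-θ) (a := conj a) (by rwa [RCLike.norm_conj])
  exact areUnitarilyEquivalent_moebiusApply ha hσ U (hW.intertwining hs ha hU)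

/-- `D` is the inclusion of function spaces: it keeps the function and changes its coordinates from
weight `s` to weight `t`, by the diagonal factors `s n / t n`. -/
theorem exists_isShift_zero_inner_kerVec (b : HilbertBasis ℕ ℂ E) {t : ℕ → ℝ} (hs : IsTempered s)
    (ht : IsTempered t) {C : ℝ} (h : ∀ n, s n ≤ C * t n) :
    ∃ D : E →L[ℂ] E, ∀ z, ‖z‖ < 1 → ∀ x,
      inner ℂ (kerVec b t z) (D x) = inner ℂ (kerVec b s z) x := by
  obtain ⟨D, hD⟩ := exists_isShift b 0 (u := fun n => s n / t n) (C := C) fun n => by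
    rw [abs_of_pos (div_pos (hs.pos n) (ht.pos n)), div_le_iff₀ (ht.pos n)]
    exact h n
  refine ⟨D, fun z hz x => ?_⟩
  refine (hasSum_inner_kerVec (b := b) ht hz (D x)).unique
    ((hasSum_inner_kerVec hs hz x).congr_fun fun n => ?_)
  have h1 := hD.repr_add x n
  rw [add_zero] at h1
  have h2 : (t n : ℂ) ≠ 0 := Complex.ofReal_ne_zero.2 (ht.pos n).ne'
  rw [h1]
  push_cast
  field_simp

end Intertwining

/-! ### Bounded composition operators and weak homogeneity. -/

section Composition

variable {E : Type*} [NormedAddCommGroup E] [InnerProductSpace ℂ E] [CompleteSpace E]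

/-- Composition with `φ_{θ,a}` is bounded on the space of power series with weight `s`. -/
def HasBoundedComposition (b : HilbertBasis ℕ ℂ E) (s : ℕ → ℝ) (θ : ℝ) (a : ℂ) : Prop :=
  ∃ C : E →L[ℂ] E, ∀ z, ‖z‖ < 1 → ∀ x,
    inner ℂ (kerVec b s z) (C x) = inner ℂ (kerVec b s (moebius θ a z)) x

/-- In the equivalent norm of the binomial weight, `U.symm` is `f ↦ j · (f ∘ φ)`; multiplying by `(1
- ā z) ^ λ` cancels `j` up to the constant `d = (1 - |a|²) ^ (λ/2)`. -/
theorem hasBoundedComposition_of_gt_neg_one (b : HilbertBasis ℕ ℂ E) {γ : ℝ} (hγ : -1 < γ) (θ : ℝ)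
    {a : ℂ} (ha : ‖a‖ < 1) : HasBoundedComposition b (powerWeight γ) θ a := by
  obtain ⟨lam, rfl⟩ : ∃ lam, γ = lam - 1 := ⟨γ + 1, by ring⟩
  have hl : 0 < lam := by linarith
  have hs := isTempered_powerWeight (lam - 1)
  have ht := isTempered_binomialWeight hl
  obtain ⟨c, -, hc⟩ := exists_bounds_binomialWeight hl
  obtain ⟨D, hD⟩ := exists_isShift_zero_inner_kerVec b hs ht fun n => (hc n).2
  obtain ⟨D', hD'⟩ := exists_isShift_zero_inner_kerVec b ht hs fun n => (hc n).1
  obtain ⟨G, hG⟩ := exists_multiplier_cpow b ht ha (lam : ℂ)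
  obtain ⟨U, hU⟩ := exists_unitary_binomialWeight b hl θ ha
  set d : ℂ := Complex.exp (lam * (Real.log (1 - ‖a‖ ^ 2) / 2)) with hd
  have hd0 : d ≠ 0 := Complex.exp_ne_zero _
  refine ⟨d⁻¹ • (D' ∘L G ∘L (U.symm.toContinuousLinearEquiv : E →L[ℂ] E) ∘L D), fun z hz x => ?_⟩
  have hU' : inner ℂ (kerVec b (binomialWeight lam) z) (U.symm (D x)) =
      moebiusMultiplier lam a z * inner ℂ (kerVec b (binomialWeight lam) (moebius θ a z)) (D x) := by
    rw [← U.inner_map_map, U.apply_symm_apply, hU z hz, inner_smul_left, Complex.conj_conj]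
  have hm : (1 - conj a * z) ^ (lam : ℂ) * moebiusMultiplier lam a z = d := by
    rw [moebiusMultiplier, Complex.cpow_def_of_ne_zero (one_sub_conj_mul_ne_zero ha hz),
      ← Complex.exp_add, hd]
    congr 1
    ring
  have h1 : (d⁻¹ • (D' ∘L G ∘L (U.symm.toContinuousLinearEquiv : E →L[ℂ] E) ∘L D)) x =
      d⁻¹ • D' (G (U.symm (D x))) := rfl
  rw [h1, inner_smul_right, hD' z hz, hG z hz, hU', ← mul_assoc _ (moebiusMultiplier lam a z), hm,
    ← mul_assoc, inv_mul_cancel₀ hd0, one_mul, hD _ (norm_moebius_lt_one θ ha hz)]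

/-- The backward shift is differentiation, from weight `γ` to weight `γ + 2`. -/
theorem exists_derivative (b : HilbertBasis ℕ ℂ E) (γ : ℝ) :
    ∃ B : E →L[ℂ] E, (∀ x z, ‖z‖ < 1 →
      HasDerivAt (fun z => inner ℂ (kerVec b (powerWeight γ) z) x)
        (inner ℂ (kerVec b (powerWeight (γ + 2)) z) (B x)) z) ∧
      ∀ W : E →L[ℂ] E, IsCoordShift b (powerWeight γ) W → ∀ x, B (W x) = x := by
  have hs := isTempered_powerWeight γ
  -- The adjoint of this shift scales the coordinate `n + 1` by `powerWeight γ (n + 1) / powerWeight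
  -- γ n`; since the weight for `γ + 2` is `n + 1` times that for `γ`, the result is the
  -- derivative's coordinates.
  obtain ⟨R, hR⟩ := exists_isCoordShift b hs.inv
  have hB : ∀ x n, b.repr (R.adjoint x) n =
      ((powerWeight γ (n + 1) / powerWeight γ n : ℝ) : ℂ) * b.repr x (n + 1) := by
    intro x n
    rw [hR.repr_adjoint, inv_div_inv]
  refine ⟨R.adjoint, fun x z hz => ?_, fun W hW x => ?_⟩
  · obtain ⟨f', hf', hsum⟩ := hasDerivAt_of_hasSum (c := fun n => powerWeight γ n * b.repr x n)
      (f := fun z => inner ℂ (kerVec b (powerWeight γ) z) x)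
      (fun z hz => hasSum_inner_kerVec hs hz x) hz
    have : f' = inner ℂ (kerVec b (powerWeight (γ + 2)) z) (R.adjoint x) := by
      refine hsum.unique ((hasSum_inner_kerVec (isTempered_powerWeight (γ + 2)) hz
        (R.adjoint x)).congr_fun fun n => ?_)
      have h1 : (powerWeight γ n : ℂ) ≠ 0 := Complex.ofReal_ne_zero.2 (hs.pos n).ne'
      rw [hB, powerWeight_add_two]
      push_cast
      field_simp
    rwa [this] at hf'
  · refine b.ext_repr fun n => ?_
    rw [hB, hW.repr_add]
    have h1 : (powerWeight γ n : ℂ) ≠ 0 := Complex.ofReal_ne_zero.2 (hs.pos n).ne'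
    have h2 : (powerWeight γ (n + 1) : ℂ) ≠ 0 := Complex.ofReal_ne_zero.2 (hs.pos (n + 1)).ne'
    push_cast
    field_simp

theorem eqOn_of_hasDerivAt {f g f' : ℂ → ℂ} (hf : ∀ z, ‖z‖ < 1 → HasDerivAt f (f' z) z)
    (hg : ∀ z, ‖z‖ < 1 → HasDerivAt g (f' z) z) (h0 : f 0 = g 0) {z : ℂ} (hz : ‖z‖ < 1) :
    f z = g z := by
  have h := (convex_ball (0 : ℂ) 1).norm_image_sub_le_of_norm_hasDerivWithin_le (f := f - g)
    (f' := fun _ => 0) (C := 0) (x := 0) (y := z)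
    (fun y hy => by
      have hy' : ‖y‖ < 1 := by simpa using hy
      simpa using ((hf y hy').sub (hg y hy')).hasDerivWithinAt)
    (by simp) (by simp) (by simpa using hz)
  simp only [Pi.sub_apply, zero_mul, norm_le_zero_iff, h0, sub_self, sub_zero] at h
  exact sub_eq_zero.1 h

theorem inner_kerVec_kerVec_zero {E : Type*} [NormedAddCommGroup E] [InnerProductSpace ℂ E]
    (b : HilbertBasis ℕ ℂ E) (γ : ℝ) {z : ℂ} (hz : ‖z‖ < 1) :
    inner ℂ (kerVec b (powerWeight γ) z) (kerVec b (powerWeight γ) 0) = 1 := by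
  refine (hasSum_inner_kerVec_kerVec (isTempered_powerWeight γ) hz (by simp)).unique ?_
  convert hasSum_single (f := fun n => ((powerWeight γ n ^ 2 : ℝ) : ℂ) * (z * conj (0 : ℂ)) ^ n) 0
    (fun n hn => by simp [hn]) using 1
  simp [powerWeight]

/-- By the chain rule, `f ∘ φ` is the constant `f(φ(0))` plus the antiderivative of `φ' · (f' ∘ φ)`,
and `φ'` is a constant times the multiplier `(1 - ā z) ^ (-2)`. -/
theorem hasBoundedComposition_of_add_two (b : HilbertBasis ℕ ℂ E) {γ : ℝ} {θ : ℝ} {a : ℂ}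
    (ha : ‖a‖ < 1) (h : HasBoundedComposition b (powerWeight (γ + 2)) θ a) :
    HasBoundedComposition b (powerWeight γ) θ a := by
  have hs := isTempered_powerWeight γ
  obtain ⟨C, hC⟩ := h
  obtain ⟨B, hB, hBW⟩ := exists_derivative b γ
  obtain ⟨W, hW⟩ := exists_isCoordShift b hs
  obtain ⟨G, hG⟩ := exists_multiplier_cpow b (isTempered_powerWeight (γ + 2)) ha (-2)
  set c : ℂ := Complex.exp (θ * Complex.I) * (1 - conj a * a) with hc
  let k0 := kerVec b (powerWeight γ) 0
  let ev := innerSL ℂ (kerVec b (powerWeight γ) (moebius θ a 0))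
  -- `k0` is the constant function `1`. Read from weight `γ + 2` to weight `γ`, the shift `W` is the
  -- antiderivative vanishing at `0`, because `B` is its left inverse.
  refine ⟨ev.smulRight k0 + c • (W ∘L G ∘L C ∘L B), fun z hz x => ?_⟩
  have happ : (ev.smulRight k0 + c • (W ∘L G ∘L C ∘L B)) x =
    inner ℂ (kerVec b (powerWeight γ) (moebius θ a 0)) x • k0 + c • W (G (C (B x))) := rfl
  rw [happ]
  have hsplit : ∀ z, ‖z‖ < 1 → inner ℂ (kerVec b (powerWeight γ) z)
      (inner ℂ (kerVec b (powerWeight γ) (moebius θ a 0)) x • k0 + c • W (G (C (B x)))) =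
      inner ℂ (kerVec b (powerWeight γ) (moebius θ a 0)) x +
        c * inner ℂ (kerVec b (powerWeight γ) z) (W (G (C (B x)))) := by
    intro z hz
    rw [inner_add_right, inner_smul_right, inner_smul_right, inner_kerVec_kerVec_zero b γ hz,
      mul_one]
  rw [hsplit z hz]
  refine eqOn_of_hasDerivAt
    (f := fun z => inner ℂ (kerVec b (powerWeight γ) (moebius θ a 0)) x +
        c * inner ℂ (kerVec b (powerWeight γ) z) (W (G (C (B x)))))
    (g := fun z => inner ℂ (kerVec b (powerWeight γ) (moebius θ a z)) x)
    (f' := fun z => c * inner ℂ (kerVec b (powerWeight (γ + 2)) z) (G (C (B x))))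
    (fun z hz => ?_) (fun z hz => ?_) ?_ hz
  · have := ((hB (W (G (C (B x)))) z hz).const_mul c).const_add
      (inner ℂ (kerVec b (powerWeight γ) (moebius θ a 0)) x)
    rwa [hBW W hW] at this
  · have h1 := (hB x _ (norm_moebius_lt_one θ ha hz)).comp z (hasDerivAt_moebius θ ha hz)
    convert! h1 using 1
    rw [hG z hz, hC z hz, hc]
    ring
  · simp only [hW.inner_kerVec hs (z := 0) (by simp)]
    simp

theorem hasBoundedComposition_powerWeight (b : HilbertBasis ℕ ℂ E) (γ : ℝ) (θ : ℝ) {a : ℂ}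
    (ha : ‖a‖ < 1) : HasBoundedComposition b (powerWeight γ) θ a := by
  have key : ∀ (n : ℕ) (γ : ℝ), -1 < γ + 2 * n →
      HasBoundedComposition b (powerWeight γ) θ a := by
    intro n
    induction n with
    | zero =>
      intro γ h
      exact hasBoundedComposition_of_gt_neg_one b (by simpa using h) θ ha
    | succ n ih =>
      intro γ h
      refine hasBoundedComposition_of_add_two b ha (ih _ ?_)
      push_cast at h
      linarith
  obtain ⟨n, hn⟩ := exists_nat_gt (-γ)
  refine key n γ ?_
  have : (0 : ℝ) ≤ n := n.cast_nonneg
  linarith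

/-- The adjoint of composition sends `k_z` to `k_{φ(z)}`, and composition with the inverse
automorphism makes it invertible. -/
theorem IsCoordShift.isWeaklyHomogeneousOperator_adjoint {b : HilbertBasis ℕ ℂ E} {γ : ℝ}
    {W : E →L[ℂ] E} (hW : IsCoordShift b (powerWeight γ) W) :
    IsWeaklyHomogeneousOperator W.adjoint := by
  have hs := isTempered_powerWeight γ
  have hσ := spectrum_adjoint_subset (hW.spectrum_subset hs)
  refine ⟨hσ, fun θ a ha => ?_⟩
  have ha' : ‖conj a‖ < 1 := by rwa [RCLike.norm_conj]
  have ha'' := norm_neg_exp_mul_lt_one (-θ) ha'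
  obtain ⟨C, hC⟩ := hasBoundedComposition_powerWeight b γ (-θ) ha'
  obtain ⟨C', hC'⟩ := hasBoundedComposition_powerWeight b γ (- -θ) ha''
  have hCC' : ∀ x, C (C' x) = x := fun x => ext_inner_kerVec (b := b) hs fun z hz => by
    rw [hC z hz, hC' _ (norm_moebius_lt_one _ ha' hz), moebius_moebius _ ha' hz]
  have hC'C : ∀ x, C' (C x) = x := fun x => ext_inner_kerVec (b := b) hs fun z hz => by
    rw [hC' z hz, hC _ (norm_moebius_lt_one _ ha'' hz), moebius_moebius' _ ha' hz]
  have h1 : C.adjoint ∘L C'.adjoint = ContinuousLinearMap.id ℂ E := by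
    rw [← ContinuousLinearMap.adjoint_comp, show C' ∘L C = ContinuousLinearMap.id ℂ E from
      ContinuousLinearMap.ext hC'C, ContinuousLinearMap.adjoint_id]
  have h2 : C'.adjoint ∘L C.adjoint = ContinuousLinearMap.id ℂ E := by
    rw [← ContinuousLinearMap.adjoint_comp, show C ∘L C' = ContinuousLinearMap.id ℂ E from
      ContinuousLinearMap.ext hCC', ContinuousLinearMap.adjoint_id]
  let L : E ≃L[ℂ] E := ContinuousLinearEquiv.equivOfInverse C.adjoint C'.adjoint
    (fun x => congrArg (fun S : E →L[ℂ] E => S x) h2)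
    (fun x => congrArg (fun S : E →L[ℂ] E => S x) h1)
  refine areSimilar_moebiusApply ha hσ L (hW.intertwining hs ha (c := fun _ => 1) fun z hz => ?_)
  change C.adjoint _ = _
  rw [one_smul]
  refine ext_inner_right ℂ fun x => ?_
  rw [ContinuousLinearMap.adjoint_inner_left, hC z hz]

end Composition

/-! ### Similarity to a homogeneous operator for `γ > -1`. -/

section SimilarToHomogeneous

variable {E : Type*} [NormedAddCommGroup E] [InnerProductSpace ℂ E] [CompleteSpace E]

theorem IsCoordShift.isSimilarToHomogeneous_adjoint {b : HilbertBasis ℕ ℂ E} {γ : ℝ} (hγ : -1 < γ)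
    {W : E →L[ℂ] E} (hW : IsCoordShift b (powerWeight γ) W) :
    IsSimilarToHomogeneous W.adjoint := by
  obtain ⟨lam, rfl⟩ : ∃ lam, γ = lam - 1 := ⟨γ + 1, by ring⟩
  have hl : 0 < lam := by linarith
  have hs := isTempered_powerWeight (lam - 1)
  have ht := isTempered_binomialWeight hl
  obtain ⟨c, -, hc⟩ := exists_bounds_binomialWeight hl
  obtain ⟨D, hD⟩ := exists_isShift_zero_inner_kerVec b hs ht fun n => (hc n).2
  obtain ⟨D', hD'⟩ := exists_isShift_zero_inner_kerVec b ht hs fun n => (hc n).1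
  obtain ⟨V, hV⟩ := exists_isCoordShift b ht
  have hDD' : D ∘L D' = ContinuousLinearMap.id ℂ E := ContinuousLinearMap.ext fun x =>
    ext_inner_kerVec (b := b) ht fun z hz => by
      rw [ContinuousLinearMap.comp_apply, hD z hz, hD' z hz, ContinuousLinearMap.id_apply]
  have hD'D : D' ∘L D = ContinuousLinearMap.id ℂ E := ContinuousLinearMap.ext fun x =>
    ext_inner_kerVec (b := b) hs fun z hz => by
      rw [ContinuousLinearMap.comp_apply, hD' z hz, hD z hz, ContinuousLinearMap.id_apply]
  have hDW : V = D ∘L W ∘L D' := ContinuousLinearMap.ext fun x =>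
    ext_inner_kerVec (b := b) ht fun z hz => by
      rw [ContinuousLinearMap.comp_apply, ContinuousLinearMap.comp_apply, hD z hz,
        hW.inner_kerVec hs hz, hD' z hz, hV.inner_kerVec ht hz]
  have h1 : D.adjoint ∘L D'.adjoint = ContinuousLinearMap.id ℂ E := by
    rw [← ContinuousLinearMap.adjoint_comp, hD'D, ContinuousLinearMap.adjoint_id]
  have h2 : D'.adjoint ∘L D.adjoint = ContinuousLinearMap.id ℂ E := by
    rw [← ContinuousLinearMap.adjoint_comp, hDD', ContinuousLinearMap.adjoint_id]
  let L : E ≃L[ℂ] E := ContinuousLinearEquiv.equivOfInverse D'.adjoint D.adjoint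
    (fun x => congrArg (fun S : E →L[ℂ] E => S x) h1)
    (fun x => congrArg (fun S : E →L[ℂ] E => S x) h2)
  refine ⟨V.adjoint, hV.isHomogeneousOperator_adjoint hl, L, ?_⟩
  rw [hDW, ContinuousLinearMap.adjoint_comp, ContinuousLinearMap.adjoint_comp]
  rfl

end SimilarToHomogeneous

/-! ### Non-similarity for `γ ≤ -1`. -/

section NotSimilar

open Filter Topology

variable {E : Type*} [NormedAddCommGroup E] [InnerProductSpace ℂ E]

theorem hasSum_norm_kerVec_sub_sq (b : HilbertBasis ℕ ℂ E) (γ : ℝ) {r t : ℝ} (hr : |r| < 1)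
    (ht : |t| < 1) : HasSum (fun n : ℕ => ((n : ℝ) + 1) ^ γ * (r ^ n - t ^ n) ^ 2)
      (‖kerVec b (powerWeight γ) r - kerVec b (powerWeight γ) t‖ ^ 2) := by
  have hs := isTempered_powerWeight γ
  refine (b.hasSum_norm_sq _).congr_fun fun n => ?_
  rw [map_sub, lp.coeFn_sub, Pi.sub_apply, repr_kerVec hs (by simpa using hr),
    repr_kerVec hs (by simpa using ht), Complex.conj_ofReal, Complex.conj_ofReal, ← mul_sub,
    norm_mul, mul_pow, Complex.norm_real, Real.norm_eq_abs, sq_abs, powerWeight_sq]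
  congr 1
  rw [← Complex.ofReal_pow, ← Complex.ofReal_pow, ← Complex.ofReal_sub, Complex.norm_real,
    Real.norm_eq_abs, sq_abs]

theorem hasSum_norm_kerVec_sq (b : HilbertBasis ℕ ℂ E) (γ : ℝ) {r : ℝ} (hr : |r| < 1) :
    HasSum (fun n : ℕ => ((n : ℝ) + 1) ^ γ * (r ^ n) ^ 2)
      (‖kerVec b (powerWeight γ) r‖ ^ 2) := by
  have hs := isTempered_powerWeight γ
  refine (b.hasSum_norm_sq _).congr_fun fun n => ?_
  rw [repr_kerVec hs (by simpa using hr), Complex.conj_ofReal,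
    norm_mul, mul_pow, Complex.norm_real, Real.norm_eq_abs, sq_abs, powerWeight_sq]
  congr 1
  rw [← Complex.ofReal_pow, Complex.norm_real, Real.norm_eq_abs, sq_abs]

theorem one_le_norm_kerVec_sq (b : HilbertBasis ℕ ℂ E) (γ : ℝ) {r : ℝ} (hr : |r| < 1) :
    1 ≤ ‖kerVec b (powerWeight γ) r‖ ^ 2 := by
  have := le_hasSum (hasSum_norm_kerVec_sq b γ hr) 0 fun n _ => by positivity
  simpa using this

/-- The point is the image of `1/2` under the automorphism `φ_{0,-r}`, which carries `0` to `r`. -/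
theorem moebius_shift_mem {r : ℝ} (h0 : 0 ≤ r) (h1 : r < 1) :
    |(1 + 2 * r) / (2 + r)| < 1 := by
  rw [abs_of_nonneg (by positivity), div_lt_one (by positivity)]
  linarith

/-- As `r → 1` both points tend to `1`, so every term of the squared distance tends to `0`,
dominated by the summable `(n + 1) ^ γ`; meanwhile `‖k_r‖ ≥ 1`. -/
theorem exists_kerVec_close_of_lt (b : HilbertBasis ℕ ℂ E) {γ : ℝ} (hγ : γ < -1) {ε : ℝ}
    (hε : 0 < ε) : ∃ r : ℝ, 0 ≤ r ∧ r < 1 ∧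
      ‖kerVec b (powerWeight γ) r - kerVec b (powerWeight γ) ((1 + 2 * r) / (2 + r) : ℝ)‖ ≤
        ε * ‖kerVec b (powerWeight γ) r‖ := by
  have hsum : Summable fun n : ℕ => ((n : ℝ) + 1) ^ γ := by
    have := (summable_nat_add_iff 1).2 (Real.summable_nat_rpow.2 hγ)
    simpa using this
  have hev : ∀ᶠ r : ℝ in 𝓝[<] 1, 0 ≤ r ∧ r < 1 := by
    filter_upwards [Ico_mem_nhdsLT (zero_lt_one' ℝ)] with r hr
    exact hr
  have hlim : Tendsto (fun r : ℝ => ∑' n : ℕ, ((n : ℝ) + 1) ^ γ *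
      (r ^ n - ((1 + 2 * r) / (2 + r)) ^ n) ^ 2) (𝓝[<] 1) (𝓝 (∑' _ : ℕ, (0 : ℝ))) := by
    refine tendsto_tsum_of_dominated_convergence (bound := fun n : ℕ => ((n : ℝ) + 1) ^ γ) hsum
      (fun n => ?_) ?_
    · have hc : ContinuousAt (fun r : ℝ => ((n : ℝ) + 1) ^ γ *
          (r ^ n - ((1 + 2 * r) / (2 + r)) ^ n) ^ 2) 1 := by
        refine continuousAt_const.mul (ContinuousAt.pow ((continuousAt_id.pow n).sub
          (ContinuousAt.pow (ContinuousAt.div ?_ ?_ ?_) n)) 2)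
        · fun_prop
        · fun_prop
        · norm_num
      have h1 := hc.tendsto.mono_left (nhdsWithin_le_nhds (s := Set.Iio 1))
      convert h1 using 2
      norm_num
    · filter_upwards [hev] with r hr n
      have h2 := abs_lt.1 (moebius_shift_mem hr.1 hr.2)
      have h3 : 0 ≤ (1 + 2 * r) / (2 + r) := by
        have := hr.1
        positivity
      have h4 := pow_le_one₀ (n := n) hr.1 hr.2.le
      have h5 := pow_le_one₀ (n := n) h3 h2.2.le
      have h6 := pow_nonneg hr.1 n
      have h7 := pow_nonneg h3 n
      rw [Real.norm_of_nonneg (by positivity)]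
      have h8 : (r ^ n - ((1 + 2 * r) / (2 + r)) ^ n) ^ 2 ≤ 1 := by
        rw [sq_le_one_iff_abs_le_one, abs_le]
        constructor <;> linarith
      exact mul_le_of_le_one_right (by positivity) h8
  rw [tsum_zero] at hlim
  obtain ⟨r, hr, hr0, hr1⟩ :=
    ((hlim.eventually (gt_mem_nhds (show (0 : ℝ) < ε ^ 2 by positivity))).and hev).exists
  refine ⟨r, hr0, hr1, ?_⟩
  have hra : |r| < 1 := by rwa [abs_of_nonneg hr0]
  rw [(hasSum_norm_kerVec_sub_sq b γ hra (moebius_shift_mem hr0 hr1)).tsum_eq] at hr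
  refine (sq_le_sq₀ (norm_nonneg _) (by positivity)).1 ?_
  rw [mul_pow]
  nlinarith [one_le_norm_kerVec_sq b γ hra, sq_nonneg ε]

/-- The logarithm of `(1 - r t)² / ((1 - r²) (1 - t²))` dominates the squared distance. This
quotient is Möbius invariant, so it equals its value `4/3` at the pair `0, 1/2`. -/
theorem norm_kerVec_sub_sq_le_log (b : HilbertBasis ℕ ℂ E) {r : ℝ} (h0 : 0 ≤ r) (h1 : r < 1) :
    ‖kerVec b (powerWeight (-1)) r - kerVec b (powerWeight (-1)) ((1 + 2 * r) / (2 + r) : ℝ)‖ ^ 2 ≤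
      Real.log (4 / 3) := by
  have hra : |r| < 1 := by rwa [abs_of_nonneg h0]
  have hta := moebius_shift_mem h0 h1
  set t := (1 + 2 * r) / (2 + r) with ht
  have ht0 : 0 ≤ t := by positivity
  rw [abs_of_nonneg ht0] at hta
  have hsub := hasSum_norm_kerVec_sub_sq b (-1) hra (moebius_shift_mem h0 h1)
  have hr2 : |r * r| < 1 := by
    rw [abs_of_nonneg (by positivity)]; nlinarith
  have ht2 : |t * t| < 1 := by
    rw [abs_of_nonneg (by positivity)]; nlinarith
  have hrt : |r * t| < 1 := by
    rw [abs_of_nonneg (by positivity)]; nlinarith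
  have hl := ((Real.hasSum_pow_div_log_of_abs_lt_one hr2).add
    (Real.hasSum_pow_div_log_of_abs_lt_one ht2)).sub
      ((Real.hasSum_pow_div_log_of_abs_lt_one hrt).mul_left 2)
  have hval : -Real.log (1 - r * r) + -Real.log (1 - t * t) - 2 * -Real.log (1 - r * t) =
      Real.log (4 / 3) := by
    have p1 : 0 < 1 - r * r := by linarith [(abs_lt.1 hr2).2]
    have p2 : 0 < 1 - t * t := by linarith [(abs_lt.1 ht2).2]
    have p3 : 0 < 1 - r * t := by linarith [(abs_lt.1 hrt).2]
    have e1 : (1 - r * t) ^ 2 = 4 / 3 * ((1 - r * r) * (1 - t * t)) := by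
      rw [ht]
      field_simp
      ring
    have e2 := congrArg Real.log e1
    rw [Real.log_pow, Real.log_mul (by norm_num) (by positivity),
      Real.log_mul p1.ne' p2.ne'] at e2
    push_cast at e2
    linarith
  rw [hval] at hl
  -- The term `n = 0` vanishes; after the shift the coefficients `1 / (n + 2)` are below the `1 / (n
  -- + 1)` of the logarithmic series.
  have hshift := (hasSum_nat_add_iff' 1).2 hsub
  simp only [Finset.range_one, Finset.sum_singleton, pow_zero, sub_self, ne_eq,
    OfNat.ofNat_ne_zero, not_false_eq_true, zero_pow, mul_zero, sub_zero] at hshift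
  refine hasSum_le (fun n => ?_) hshift hl
  have hn : (0 : ℝ) < (n : ℝ) + 1 := by positivity
  have e3 : (r * r) ^ (n + 1) / ((n : ℝ) + 1) + (t * t) ^ (n + 1) / ((n : ℝ) + 1) -
      2 * ((r * t) ^ (n + 1) / ((n : ℝ) + 1)) =
      ((n : ℝ) + 1)⁻¹ * (r ^ (n + 1) - t ^ (n + 1)) ^ 2 := by
    simp only [mul_pow]
    field_simp
    ring
  rw [e3, Real.rpow_neg_one]
  push_cast
  gcongr
  linarith

/-- At `γ = -1` the distance does not shrink but stays bounded, while `‖k_r‖² ≥ -log (1 - r²)` tends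
to infinity. -/
theorem exists_kerVec_close (b : HilbertBasis ℕ ℂ E) {γ : ℝ} (hγ : γ ≤ -1) {ε : ℝ}
    (hε : 0 < ε) : ∃ r : ℝ, 0 ≤ r ∧ r < 1 ∧
      ‖kerVec b (powerWeight γ) r - kerVec b (powerWeight γ) ((1 + 2 * r) / (2 + r) : ℝ)‖ ≤
        ε * ‖kerVec b (powerWeight γ) r‖ := by
  rcases hγ.lt_or_eq with h | rfl
  · exact exists_kerVec_close_of_lt b h hε
  have hlim : Tendsto (fun r : ℝ => -Real.log (1 - r ^ 2)) (𝓝[<] 1) atTop := by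
    refine tendsto_neg_atBot_atTop.comp (Real.tendsto_log_nhdsGT_zero.comp ?_)
    refine tendsto_nhdsWithin_iff.2 ⟨?_, ?_⟩
    · have : ContinuousAt (fun r : ℝ => 1 - r ^ 2) 1 := by fun_prop
      have h1 := this.tendsto.mono_left (nhdsWithin_le_nhds (s := Set.Iio 1))
      simpa using h1
    · filter_upwards [Ico_mem_nhdsLT (zero_lt_one' ℝ)] with r hr
      have := hr.1
      have := hr.2
      simp only [Set.mem_Ioi]
      nlinarith
  obtain ⟨r, hr, hr0, hr1⟩ := ((hlim.eventually_ge_atTop (Real.log (4 / 3) / ε ^ 2)).and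
    (Ico_mem_nhdsLT (zero_lt_one' ℝ))).exists
  refine ⟨r, hr0, hr1, ?_⟩
  have hra : |r| < 1 := by rwa [abs_of_nonneg hr0]
  have hr2 : |r ^ 2| < 1 := by
    rw [abs_of_nonneg (by positivity)]; nlinarith
  refine (sq_le_sq₀ (norm_nonneg _) (by positivity)).1 ?_
  rw [mul_pow]
  refine (norm_kerVec_sub_sq_le_log b hr0 hr1).trans ?_
  rw [div_le_iff₀ (by positivity)] at hr
  rw [mul_comm]
  refine hr.trans ?_
  gcongr
  refine hasSum_le (fun n => ?_) (Real.hasSum_pow_div_log_of_abs_lt_one hr2)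
    (hasSum_norm_kerVec_sq b (-1) hra)
  rw [Real.rpow_neg_one, ← pow_mul, ← pow_mul, div_eq_inv_mul, mul_comm n 2]
  gcongr ?_ * ?_
  exact pow_le_pow_of_le_one hr0 hr1.le (by omega)

variable [CompleteSpace E]

theorem IsCoordShift.not_isSimilarToHomogeneous_adjoint {b : HilbertBasis ℕ ℂ E} {γ : ℝ}
    (hγ : γ ≤ -1) {W : E →L[ℂ] E} (hW : IsCoordShift b (powerWeight γ) W) :
    ¬ IsSimilarToHomogeneous W.adjoint := by
  rintro ⟨S, ⟨hσ, hS⟩, L, hL⟩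
  have hs := isTempered_powerWeight γ
  set k : ℝ → E := fun r => kerVec b (powerWeight γ) r with hk
  have hSL : ∀ x, S (L x) = L (W.adjoint x) := by
    intro x
    rw [← hL]
    simp
  have heig : ∀ r : ℝ, |r| < 1 → S (L (k r)) = (r : ℂ) • L (k r) := by
    intro r hr
    rw [hSL, hk, hW.adjoint_kerVec hs (by simpa using hr), Complex.conj_ofReal, map_smul]
  have hone : ∀ r : ℝ, |r| < 1 → ∀ y : E, S y = (r : ℂ) • y → ∃ c : ℂ, y = c • L (k r) := by
    intro r hr y hy
    obtain ⟨c, hc⟩ := hW.eq_smul_kerVec hs (w := (r : ℂ)) (by simpa using hr) (x := L.symm y) (by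
      apply L.injective
      rw [← hSL, L.apply_symm_apply, hy, Complex.conj_ofReal, map_smul, L.apply_symm_apply])
    refine ⟨c, ?_⟩
    rw [← map_smul, hk, ← hc, L.apply_symm_apply]
  have hk0 : ∀ r : ℝ, |r| < 1 → L (k r) ≠ 0 := by
    intro r hr h
    refine kerVec_ne_zero (b := b) hs (w := (r : ℂ)) (by simpa using hr) ?_
    simpa using h
  have hhalf : |(1 / 2 : ℝ)| < 1 := by rw [abs_of_pos] <;> norm_num
  have hzero : |(0 : ℝ)| < 1 := by simp
  -- the eigenvectors at `0` and `1/2` are independent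
  have hnot : L (k 0) ∉ (Submodule.span ℂ {L (k (1 / 2))} : Set E) := by
    intro h
    obtain ⟨c, hc⟩ := Submodule.mem_span_singleton.1 h
    have h1 := congrArg S hc
    rw [map_smul, heig _ hhalf, heig _ hzero, smul_comm, hc] at h1
    have h2 : ((1 / 2 : ℝ) : ℂ) • L (k 0) = 0 := by rw [h1]; simp
    rcases smul_eq_zero.1 h2 with h3 | h3
    · norm_num at h3
    · exact hk0 0 hzero h3
  have hclosed : IsClosed (Submodule.span ℂ {L (k (1 / 2))} : Set E) :=
    Submodule.closed_of_finiteDimensional _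
  set δ := Metric.infDist (L (k 0)) (Submodule.span ℂ {L (k (1 / 2))} : Set E) with hδ
  have hδ0 : 0 < δ :=
    (hclosed.notMem_iff_infDist_pos ⟨0, Submodule.zero_mem _⟩).1 hnot
  -- moving both eigenvectors to the boundary makes them almost parallel
  have hmove : ∀ r : ℝ, 0 ≤ r → r < 1 →
      δ * ‖L (k r)‖ ≤ ‖L (k 0)‖ * ‖L (k r) - L (k ((1 + 2 * r) / (2 + r)))‖ := by
    intro r h0 h1
    have hra : |r| < 1 := by rwa [abs_of_nonneg h0]
    have hta := moebius_shift_mem h0 h1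
    have hna : ‖(-r : ℂ)‖ < 1 := by rw [norm_neg]; simpa using hra
    -- `U` carries the eigenlines of `S` at `0` and `1/2` onto those at `r` and `(1 + 2r)/(2 + r)`,
    -- with factors `α` and `β`.
    obtain ⟨U, hU⟩ := hS 0 (-r) hna
    have hUe : ∀ w : ℝ, |w| < 1 → S (U (L (k w))) = moebius 0 (-r) w • U (L (k w)) := by
      intro w hw
      rw [← hU, U.symm_apply_apply,
        moebiusApply_apply_of_eigenvector hna hσ (by simpa using hw) (heig w hw), map_smul]
    have hm0 : moebius 0 (-r) (0 : ℝ) = (r : ℂ) := by simp [moebius]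
    have hm1 : moebius 0 (-r) (1 / 2 : ℝ) = (((1 + 2 * r) / (2 + r) : ℝ) : ℂ) := by
      have hne : (2 + r : ℂ) ≠ 0 := by
        have : (2 + r : ℝ) ≠ 0 := by positivity
        exact_mod_cast this
      simp only [moebius, Complex.ofReal_zero, zero_mul, Complex.exp_zero, map_neg,
        Complex.conj_ofReal]
      push_cast
      have hne2 : (1 - -(r : ℂ) * (1 / 2)) ≠ 0 := by
        intro h
        apply hne
        linear_combination 2 * h
      rw [one_mul, div_eq_div_iff hne2 hne]
      ring
    obtain ⟨α, hα⟩ := hone r hra _ (by rw [hUe 0 hzero, hm0])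
    obtain ⟨β, hβ⟩ := hone _ hta _ (by rw [hUe (1 / 2) hhalf, hm1])
    have hβ0 : β ≠ 0 := by
      rintro rfl
      rw [zero_smul] at hβ
      exact hk0 _ hhalf (by simpa using hβ)
    have hnα : ‖L (k 0)‖ = ‖α‖ * ‖L (k r)‖ := by
      rw [← norm_smul, ← hα, U.norm_map]
    have hle : δ ≤ ‖α‖ * ‖L (k r) - L (k ((1 + 2 * r) / (2 + r)))‖ := by
      -- The coefficient `α / β` is chosen so that `U` sends this point of the line to `α • L (k ((1
      -- + 2r)/(2 + r)))`, with the same factor as the image of `L (k 0)`.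
      have hd := Metric.infDist_le_dist_of_mem (x := L (k 0))
        (Submodule.smul_mem _ (α / β) (Submodule.mem_span_singleton_self (R := ℂ) (L (k (1 / 2)))))
      refine hd.trans_eq ?_
      rw [dist_eq_norm, ← U.norm_map, map_sub, map_smul, hα, hβ, smul_smul, div_mul_cancel₀ _ hβ0,
        ← smul_sub, norm_smul]
    calc δ * ‖L (k r)‖ ≤ (‖α‖ * ‖L (k r) - L (k ((1 + 2 * r) / (2 + r)))‖) * ‖L (k r)‖ := by gcongr
      _ = _ := by rw [hnα]; ring
  set A : ℝ := ‖L (k 0)‖ * ‖(L : E →L[ℂ] E)‖ * ‖(L.symm : E →L[ℂ] E)‖ with hA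
  have hA0 : 0 ≤ A := by positivity
  -- `A` collects the losses from `L` and `L.symm`; this `ε` satisfies `A * ε < δ` even when `A` is
  -- small, contradicting `hmove`.
  obtain ⟨r, h0, h1, hr⟩ := exists_kerVec_close b hγ (ε := δ / (2 * (A + 1))) (by positivity)
  have hra : |r| < 1 := by rwa [abs_of_nonneg h0]
  have hpos : 0 < ‖L (k r)‖ := norm_pos_iff.2 (hk0 r hra)
  have e1 : ‖L (k r) - L (k ((1 + 2 * r) / (2 + r)))‖ ≤
      ‖(L : E →L[ℂ] E)‖ * ‖k r - k ((1 + 2 * r) / (2 + r))‖ := by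
    rw [← map_sub]
    exact (L : E →L[ℂ] E).le_opNorm _
  have e2 : ‖k r‖ ≤ ‖(L.symm : E →L[ℂ] E)‖ * ‖L (k r)‖ := by
    have := (L.symm : E →L[ℂ] E).le_opNorm (L (k r))
    simpa using this
  have e3 : δ * ‖L (k r)‖ ≤ A * (δ / (2 * (A + 1))) * ‖L (k r)‖ := by
    calc δ * ‖L (k r)‖ ≤ ‖L (k 0)‖ * (‖(L : E →L[ℂ] E)‖ *
          (δ / (2 * (A + 1)) * (‖(L.symm : E →L[ℂ] E)‖ * ‖L (k r)‖))) := by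
          refine (hmove r h0 h1).trans ?_
          gcongr
          refine e1.trans ?_
          gcongr
          refine hr.trans ?_
          gcongr
      _ = _ := by rw [hA]; ring
  have e4 := le_of_mul_le_mul_right e3 hpos
  have e5 : A * (δ / (2 * (A + 1))) < δ := by
    rw [mul_div_assoc', div_lt_iff₀ (by positivity)]
    nlinarith
  linarith

end NotSimilar

/-! ### Transfer to the reproducing kernel Hilbert space. -/

section Main

variable {H : Type*} [NormedAddCommGroup H] [InnerProductSpace ℂ H] [CompleteSpace H]
  [RKHS ℂ H Complex.UnitDisc ℂ]

/-- The kernel functions of `H` and the vectors `kerVec` in `ℓ²` are total families with the same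
Gram matrix; the resulting unitary onto `ℓ²` is the basis. -/
theorem exists_hilbertBasis_of_kernel_eq {γ : ℝ} (h : RKHS.kernel H = powerKernel γ) :
    ∃ b : HilbertBasis ℕ ℂ H, ∀ (z : Complex.UnitDisc) (f : H),
      inner ℂ (kerVec b (powerWeight γ) z) f = f z := by
  let b0 : HilbertBasis ℕ ℂ (lp (fun _ : ℕ => ℂ) 2) := ⟨LinearIsometryEquiv.refl ℂ _⟩
  have hs := isTempered_powerWeight γ
  have hdense : (Submodule.span ℂ (Set.range fun z : Complex.UnitDisc =>
      RKHS.kerFun H z (1 : ℂ))).topologicalClosure = ⊤ := by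
    rw [eq_top_iff, ← RKHS.kerFun_dense H]
    refine Submodule.topologicalClosure_mono (Submodule.span_le.2 ?_)
    rintro _ ⟨z, v, rfl⟩
    have : RKHS.kerFun H z v = v • RKHS.kerFun H z (1 : ℂ) := by
      rw [← map_smul, smul_eq_mul, mul_one]
    rw [this]
    exact Submodule.smul_mem _ _ (Submodule.subset_span ⟨z, rfl⟩)
  obtain ⟨V, hV⟩ := exists_linearIsometryEquiv_of_inner_eq hdense
    (topologicalClosure_span_kerVec (b := b0) hs) (fun z w => by
      rw [RKHS.kerFun_inner, RKHS.kerFun_apply, h, RCLike.inner_apply, map_one (starRingEnd ℂ), mul_one]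
      have h1 := hasSum_inner_kerVec_kerVec (b := b0) hs z.norm_lt_one w.norm_lt_one
      simp only [powerWeight_sq] at h1
      rw [← h1.tsum_eq]
      simp [powerKernel])
  refine ⟨⟨V⟩, fun z f => ?_⟩
  have hk : kerVec (⟨V⟩ : HilbertBasis ℕ ℂ H) (powerWeight γ) z = RKHS.kerFun H z (1 : ℂ) := by
    refine V.injective ?_
    rw [hV]
    refine lp.ext (funext fun n => ?_)
    have h1 := repr_kerVec (b := (⟨V⟩ : HilbertBasis ℕ ℂ H)) hs z.norm_lt_one n
    have h2 := repr_kerVec (b := b0) hs z.norm_lt_one n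
    exact h1.trans h2.symm
  rw [hk, RKHS.kerFun_inner]
  simp

theorem exists_isMulCoord_isCoordShift {γ : ℝ} (h : RKHS.kernel H = powerKernel γ) :
    ∃ (M : H →L[ℂ] H) (b : HilbertBasis ℕ ℂ H), IsMulCoord M ∧ IsCoordShift b (powerWeight γ) M := by
  obtain ⟨b, hb⟩ := exists_hilbertBasis_of_kernel_eq h
  obtain ⟨W, hW⟩ := exists_isCoordShift b (isTempered_powerWeight γ)
  refine ⟨W, b, fun f z => ?_, hW⟩
  rw [← hb, hW.inner_kerVec (isTempered_powerWeight γ) z.norm_lt_one, hb]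

end Main

theorem mainTheorem11 {H : Type*} [NormedAddCommGroup H] [InnerProductSpace ℂ H]
    [CompleteSpace H] [RKHS ℂ H Complex.UnitDisc ℂ] :
    (∀ γ : ℝ, RKHS.kernel H = powerKernel γ →
      ∃ M : H →L[ℂ] H, IsMulCoord M ∧
        IsWeaklyHomogeneousOperator M.adjoint ∧
        IsCowenDouglas 1 (Metric.ball 0 1) M.adjoint ∧
        (IsSimilarToHomogeneous M.adjoint ↔ -1 < γ)) ∧
    (RKHS.kernel H = powerKernel (-1) →
      ∃ M : H →L[ℂ] H, IsMulCoord M ∧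
        IsWeaklyHomogeneousOperator M.adjoint ∧
        ¬ IsSimilarToHomogeneous M.adjoint) := by
  refine ⟨fun γ h => ?_, fun h => ?_⟩
  · obtain ⟨M, b, hM, hW⟩ := exists_isMulCoord_isCoordShift h
    refine ⟨M, hM, hW.isWeaklyHomogeneousOperator_adjoint,
      hW.isCowenDouglas_adjoint (isTempered_powerWeight γ), fun hsim => ?_,
      fun hγ => hW.isSimilarToHomogeneous_adjoint hγ⟩
    by_contra hγ
    exact hW.not_isSimilarToHomogeneous_adjoint (not_lt.1 hγ) hsim
  · obtain ⟨M, b, hM, hW⟩ := exists_isMulCoord_isCoordShift h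
    exact ⟨M, hM, hW.isWeaklyHomogeneousOperator_adjoint,
      hW.not_isSimilarToHomogeneous_adjoint le_rfl⟩
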